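/- **Model.** Macro base stations (MBSs), small-cell base stations (SBSs) and users form independent homogeneous Poisson point processes in $\mathbb{R}^2$ with densities $\lambda_m,\lambda_s,\lambda_u>0$; a typical uplink (UL) user is added at the origin $0$. Independently, each other user is UL with probability $1-\eta$ and downlink (DL) with probability $\eta$. A link of length $d$ has path loss $L=d^{\alpha_l}$ (LOS) with probability $p_{LOS}\mathbb{1}(d\le d_{LOS})$ and $L=d^{\alpha_n}$ otherwise, independently over links. A user associates with the base station (BS), of tier $t\in\{m,s\}$, that maximizes $P_tG_tB_tL^{-1}$; an SBS connects to the MBS of least path loss. $\mathcal E_t$ is the event that the typical user associates with tier $t$, $X^*$ its BS, $X^{**}$ the MBS of $X^*$ on $\mathcal E_s$, and $\mathcal A_t=\mathbb P(\mathcal E_t)$. A transmission from $Y$ to $X$ in slot $i$ is received with power $C_0P_Yh\,G\,L^{-1}$, where $h$ is unit-mean exponential; $G$ is the product of the two main-lobe gains for a desired link, and for an interfering link it is the product of two independent gains, each equal to the main-lobe gain $G_\cdot$ with probability $\Delta_\cdot/2\pi$ and to the side-lobe gain $g_\cdot$ otherwise. Fading and gains are independent over links, and arbitrarily correlated over slots.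 *Frames.* A frame has $F$ slots of duration $T$: $F_a$ access slots, $F_{bd}$ DL backhaul slots, then the UL backhaul slots $F_a+F_{bd}<i\le F$. Let $\mathrm{rd}(x)$ be $\lceil x\rceil$ with probability $x-\lfloor x\rfloor$ and $\lfloor x\rfloor$ otherwise. Then $F_a=\mathrm{rd}(\delta F)$, $F_{bd}=\mathrm{rd}(\eta(F-F_a))$. The first $F_{ad}$ access slots of a BS are DL, the others UL. Under static TDD ($w_a=S$) $F_{ad}=\mathrm{rd}(\gamma_aF_a)$ with $\gamma_a\in[0,1]$ constant, one value for all BSs. Under dynamic TDD ($w_a=D$) $F_{ad}=\mathrm{rd}\big(F_aN_d/(N_u+N_d)\big)$ (zero if $N_d=0$), rounded independently for each BS, where $N_u,N_d$ are its numbers of UL and DL users. $\mathcal F$ denotes $F_a$, $F_{bd}$, and (static TDD) $F_{ad}$. *Loads* are independent marks, independent of everything else. With $\epsilon=\lambda_u\mathcal A_t/\lambda_t$ put $$\Upsilon_t(n_1,n_2,k)=\frac{3.5^{3.5}}{\Gamma(3.5)}\frac{\eta^{n_2}(1-\eta)^{n_1}}{n_1!\,n_2!}\frac{\Gamma(n_1+n_2+k)}{\epsilon^k(1+3.5/\epsilon)^{n_1+n_2+k}}.$$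 A BS of tier $t$ has $(N_u,N_d)\sim\Upsilon_t(\cdot,\cdot,3.5)$; on $\mathcal E_t$, $X^*$ has $(N_u-1,N_d)\sim\Upsilon_t(\cdot,\cdot,4.5)$. The number $N_{s,u}$ of SBSs with at least one UL user of an MBS has PMF $\kappa(n)=\frac{3.5^{3.5}\Gamma(n+3.5)\epsilon^{n}(3.5+\epsilon)^{-n-3.5}}{n!\,\Gamma(3.5)}$, $n\ge0$, and that of $X^{**}$ has PMF $\kappa^*(n)=\frac{3.5^{3.5}\Gamma(n+3.5)\epsilon^{n-1}(3.5+\epsilon)^{-n-3.5}}{(n-1)!\,\Gamma(3.5)}$, $n\ge1$, both with $\epsilon=\frac{\lambda_s}{\lambda_m}\big(1-(1+\frac{\mathcal A_s\lambda_u(1-\eta)}{3.5\lambda_s})^{-3.5}\big)$. Let $\kappa^*_{u,s}$ be $\kappa^*$ with $\epsilon=(1-\eta)\lambda_u\mathcal A_s/\lambda_s$. *Scheduling.* In each UL access slot a BS schedules a uniformly random UL user of its own; in each UL backhaul slot an MBS schedules a uniformly random one of its SBSs with at least one UL user. Under SAB an unscheduled SBS is silent; under UAB it schedules, with probability $p_{ul}$,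 a uniformly random UL user of its own (poaching). The typical user is chosen with probability $1/N_u$ at $X^*$; $X^*$ is scheduled by $X^{**}$ with probability $1/N_{s,u}$ and then carries the typical user's data with probability $1/N_u$; these choices are independent of everything else. A BS other than $X^*$ (or an MBS other than $X^{**}$) whose load mark is zero schedules nobody. *SINR.* In an access slot $i\le F_a$, $\mathsf{SINR}^{ul}_{i,a,w_a}$ is the power received at $X^*$ from the typical user, divided by noise $\sigma^2>0$ plus interference at $X^*$ from the other BSs with $i\le F_{ad}$, $N_d>0$ and from the UL users scheduled by the other BSs with $F_{ad}<i$, $N_u>0$. In a UL backhaul slot, $\mathsf{SINR}^{ul}_{i,a,\mathrm{UAB}}$ at $X^*$ (for $X^*$ not scheduled by $X^{**}$) and $\mathsf{SINR}^{ul}_{i,b,w_b}$ at $X^{**}$ from $X^*$ (for $X^*$ scheduled) have interference from the other SBSs scheduled by MBSs and, under UAB, from the UL users of the other, poaching SBSs. Put $\mathsf S^{ul,t}_{i,a,w_a}(\tau)=\mathbb P(\mathsf{SINR}^{ul}_{i,a,w_a}>\tau\mid\mathcal E_t,\mathcal F)$ and, similarly given $\mathcal E_s$, $\mathsf S^{ul,s}_{i,a,\mathrm{UAB}}$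 and $\mathsf S^{ul}_{i,b,w_b}$. *Rates.* Let $D_m$, $D_a$ and $D_b$ be the sums of $WT\log_2(1+\mathsf{SINR})$ over the slots of a frame in which, respectively, the typical user transmits to its MBS, the typical user transmits to its SBS (in access or poached slots), and its SBS forwards its data. The mean rate of the typical UL user is $\mathcal A_mR_m+\mathcal A_sR_s$ with $R_m=\mathbb E[D_m\mid\mathcal E_m]/(TF)$ and $R_s=\mathbb E\big[\min(\mathbb E[D_a\mid\mathcal G],\mathbb E[D_b\mid\mathcal G])\mid\mathcal E_s\big]/(TF)$, where $\mathcal G$ is generated by the points, blockage, user types and loads. Its approximation replaces $R_s$ by $\mathbb E_{\mathcal F}\min\big(\mathbb E[D_a\mid\mathcal E_s,\mathcal F],\mathbb E[D_b\mid\mathcal E_s,\mathcal F]\big)/(TF)$. **Theorem.** For $w_a\in\{S,D\}$, $w_b\in\{\mathrm{SAB},\mathrm{UAB}\}$, the approximate mean rate of a typical UL user is $R_{ul,w_a,w_b}=\mathcal A_mR_{ul,m,w_a}+\mathcal A_sR_{ul,s,w_a,w_b}$, where, with values in $[0,\infty]$ and empty sums equal to zero, $$R_{ul,m,w_a}=\mathbb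 E_{\mathcal F}\frac WF\sum_{n_1,n_2\ge0}\frac{\Upsilon_m(n_1,n_2,4.5)}{n_1+1}\,\mathbb E_{F_{ad}}\frac1{\ln2}\int_0^\infty\frac{\sum_{i=1+F_{ad}}^{F_a}\mathsf S^{ul,m}_{i,a,w_a}(\tau)}{1+\tau}d\tau ,\qquad R_{ul,s,w_a,w_b}=\mathbb E_{\mathcal F}\frac{\min(R_a,R_b)}F,$$ $$R_a=W\sum_{n_1,n_2\ge0}\frac{\Upsilon_s(n_1,n_2,4.5)}{n_1+1}\,\mathbb E_{F_{ad}}\frac1{\ln2}\int_0^\infty\frac{\sum_{i=1+F_{ad}}^{F_a}\mathsf S^{ul,s}_{i,a,w_a}(\tau)}{1+\tau}d\tau$$ $$\qquad+\mathbb 1(w_b=\mathrm{UAB})\,W\big(1-\mathbb E[1/N_{s,u}]\big)p_{ul}\sum_{n\ge1}\frac{\kappa^*_{u,s}(n)}n\,\frac1{\ln2}\int_0^\infty\frac{\sum_{i=1+F_a+F_{bd}}^{F}\mathsf S^{ul,s}_{i,a,\mathrm{UAB}}(\tau)}{1+\tau}d\tau,$$ $$R_b=W\,\mathbb E[1/N_{s,u}]\sum_{n\ge1}\frac{\kappa^*_{u,s}(n)}n\,\frac1{\ln2}\int_0^\infty\frac{\sum_{i=1+F_a+F_{bd}}^{F}\mathsf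 S^{ul}_{i,b,w_b}(\tau)}{1+\tau}d\tau .$$ Here $\mathbb E_{F_{ad}}$ is the mean over $F_{ad}$ of $X^*$ given $\mathcal F$ and the loads $N_u=n_1+1$, $N_d=n_2$, and $N_{s,u}$ is that of $X^{**}$. More precisely, $R_m=R_{ul,m,w_a}$ exactly, $\mathbb E[D_a\mid\mathcal E_s,\mathcal F]=T R_a$ and $\mathbb E[D_b\mid\mathcal E_s,\mathcal F]=T R_b$ for every value of $\mathcal F$, and the exact mean rate is at most $\mathcal A_mR_{ul,m,w_a}+\mathcal A_s\min(\mathbb E_{\mathcal F}R_a,\mathbb E_{\mathcal F}R_b)/F$. -/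

import Mathlib

open MeasureTheory ProbabilityTheory
open scoped ENNReal

namespace MmWave

noncomputable section

/-! ### Model parameters -/

/-- The two tiers of base stations: macro (`m`) and small cell (`s`). -/
inductive Tier | m | s

/-- The three kinds of devices: macro base station, small-cell base station, user. -/
inductive Kind | m | s | u

/-- The kind of device of a base station of a given tier. -/
def Tier.kind : Tier → Kind
  | .m => .m
  | .s => .s

/-- Static or dynamic TDD in the access subframe. -/
inductive AccessScheme | static | dynamic

/-- Synchronized (`SAB`) or unsynchronized (`UAB`, poaching) access-backhaul scheduling. -/
inductive BackhaulScheme | SAB | UAB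

/-- The constants of the model. -/
structure Params where
  /-- densities of the point processes of MBSs, SBSs and users -/
  lam : Kind → ℝ
  /-- transmit powers -/
  pow : Kind → ℝ
  /-- main lobe gains -/
  gMain : Kind → ℝ
  /-- side lobe gains -/
  gSide : Kind → ℝ
  /-- 3 dB beam widths -/
  beam : Kind → ℝ
  /-- association biases -/
  bias : Tier → ℝ
  /-- LOS probability inside the LOS ball, and radius of that ball -/
  pLOS : ℝ
  dLOS : ℝ
  /-- LOS and NLOS path loss exponents -/
  alphaL : ℝ
  alphaN : ℝ
  /-- reference path loss at 1 m -/
  c0 : ℝ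
  /-- thermal noise power -/
  sigma2 : ℝ
  /-- bandwidth -/
  W : ℝ
  /-- slot duration -/
  T : ℝ
  /-- number of slots in a frame -/
  F : ℕ
  /-- fraction of slots for access -/
  delta : ℝ
  /-- fraction of downlink users, also the downlink fraction of the backhaul subframe -/
  eta : ℝ
  /-- downlink fraction of the access subframe under static TDD -/
  gammaA : ℝ
  /-- probability of poaching an unscheduled uplink backhaul slot -/
  pul : ℝ
  lam_pos : ∀ κ, 0 < lam κ
  pow_pos : ∀ κ, 0 < pow κ
  gMain_pos : ∀ κ, 0 < gMain κ
  gSide_nonneg : ∀ κ, 0 ≤ gSide κ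
  beam_pos : ∀ κ, 0 < beam κ
  beam_le : ∀ κ, beam κ ≤ 2 * Real.pi
  bias_pos : ∀ t, 0 < bias t
  pLOS_mem : pLOS ∈ Set.Icc (0 : ℝ) 1
  dLOS_nonneg : 0 ≤ dLOS
  alphaL_pos : 0 < alphaL
  alphaN_pos : 0 < alphaN
  c0_pos : 0 < c0
  sigma2_pos : 0 < sigma2
  W_pos : 0 < W
  T_pos : 0 < T
  F_pos : 0 < F
  delta_mem : delta ∈ Set.Icc (0 : ℝ) 1
  eta_mem : eta ∈ Set.Icc (0 : ℝ) 1
  gammaA_mem : gammaA ∈ Set.Icc (0 : ℝ) 1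
  pul_mem : pul ∈ Set.Icc (0 : ℝ) 1

/-! ### Generalities -/

/-- Positions in the plane. -/
abbrev Pos := EuclideanSpace ℝ (Fin 2)

/-- A base station: its tier and its label within the tier. -/
abbrev BS := Tier × ℕ

/-- The nodes of the network: the typical user (at the origin), the base stations, and the
other users. -/
inductive Node
  | user0
  | bs (b : BS)
  | ue (k : ℕ)

/-- The kind of a node. -/
def Node.kind : Node → Kind
  | .user0 => .u
  | .bs b => b.1.kind
  | .ue _ => .u

open Classical in
/-- Indicator of a proposition. -/
def ind (P : Prop) : ℝ≥0∞ := if P then 1 else 0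

/-- The uniform distribution on `[0, 1]`. -/
def unif : Measure ℝ := volume.restrict (Set.Icc 0 1)

instance : IsProbabilityMeasure unif := ⟨by simp [unif]⟩

/-- I.i.d. uniform variables on `[0, 1]`, one for each label. -/
def coins (ι : Type) : Measure (ι → ℝ) := Measure.infinitePi fun _ => unif

instance (ι : Type) : IsProbabilityMeasure (coins ι) := by unfold coins; infer_instance

/-- Randomized rounding of `x ≥ 0` with a uniform variable `u`: the value is `⌈x⌉` with
probability `x - ⌊x⌋`, and `⌊x⌋` otherwise. -/
def randRound (x u : ℝ) : ℕ := if u < Int.fract x then ⌈x⌉₊ else ⌊x⌋₊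

/-- Mean of `g` under the law of the randomized rounding of `x`. -/
def roundMean (x : ℝ) (g : ℕ → ℝ≥0∞) : ℝ≥0∞ :=
  ENNReal.ofReal (Int.fract x) * g ⌈x⌉₊ + ENNReal.ofReal (1 - Int.fract x) * g ⌊x⌋₊

/-- Among the candidates `C`, the label `y` has the smallest priority. With i.i.d. uniform
priorities this is a uniformly random choice from a finite set of candidates. -/
def Winner (C : ℕ → Prop) (prio : ℕ → ℝ) (y : ℕ) : Prop :=
  C y ∧ ∀ y', y' ≠ y → C y' → prio y < prio y'

/-- `log₂ (1 + x)` for `x ∈ [0, ∞]`. -/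
def log2p (x : ℝ≥0∞) : ℝ≥0∞ :=
  if x = ∞ then ∞ else ENNReal.ofReal (Real.logb 2 (1 + x.toReal))

/-! ### Frames -/

/-- The subframe lengths shared by all base stations. -/
structure Frame where
  /-- slots of the access subframe -/
  Fa : ℕ
  /-- downlink slots of the backhaul subframe -/
  Fbd : ℕ
  /-- downlink access slots under static TDD -/
  Fad : ℕ

/-- Expectation over the shared subframe lengths. -/
def frameMean (p : Params) (g : Frame → ℝ≥0∞) : ℝ≥0∞ :=
  roundMean (p.delta * p.F) fun Fa =>
    roundMean (p.eta * ((p.F : ℝ) - Fa)) fun Fbd =>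
      roundMean (p.gammaA * Fa) fun Fad => g ⟨Fa, Fbd, Fad⟩

/-- Downlink fraction of dynamic TDD for given numbers of uplink and downlink users. -/
def dlShare (nu nd : ℕ) : ℝ := if 0 < nd then (nd : ℝ) / ((nu : ℝ) + nd) else 0

/-- Number of downlink access slots of a base station with `nu` uplink and `nd` downlink users;
`u` is the rounding variable of that base station. -/
def fadOf (w : AccessScheme) (f : Frame) (nu nd : ℕ) (u : ℝ) : ℕ :=
  match w with
  | .static => f.Fad
  | .dynamic => randRound (dlShare nu nd * f.Fa) u

/-- Mean of `g` under the law of the number of downlink access slots. -/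
def fadMean (w : AccessScheme) (f : Frame) (nu nd : ℕ) (g : ℕ → ℝ≥0∞) : ℝ≥0∞ :=
  match w with
  | .static => g f.Fad
  | .dynamic => roundMean (dlShare nu nd * f.Fa) g

/-! ### Geometry, blockage and association -/

/-- Number of points of an enumerated configuration in a set. -/
def count (x : ℕ → Pos) (A : Set Pos) : ℝ≥0∞ :=
  ∑' k, A.indicator (fun _ => (1 : ℝ≥0∞)) (x k)

/-- `μ` is the law of an enumeration of the points of a homogeneous Poisson point process of
density `lam`. -/
structure IsPPP (lam : ℝ) (μ : Measure (ℕ → Pos)) : Prop where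
  poisson : ∀ A : Set Pos, MeasurableSet A → volume A ≠ ∞ → ∀ n : ℕ,
    μ {x | count x A = n} = ENNReal.ofReal
      (Real.exp (-(lam * (volume A).toReal)) * (lam * (volume A).toReal) ^ n / n.factorial)
  indep : ∀ (n : ℕ) (A : Fin n → Set Pos), (∀ i, MeasurableSet (A i)) →
    Pairwise (fun i j => Disjoint (A i) (A j)) → iIndepFun (fun i x => count x (A i)) μ

/-- Labels of the spatial uniform variables: blockage of each (unordered) pair of nodes, and
type (uplink or downlink) of each user. -/
inductive GeoCoin
  | link (e : Sym2 Node)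
  | dir (k : ℕ)

/-- A spatial configuration: locations of all points, blockage, and user types. -/
abbrev Geo := (Kind → ℕ → Pos) × (GeoCoin → ℝ)

/-- Location of a node. -/
def pos (g : Geo) : Node → Pos
  | .user0 => 0
  | .bs b => g.1 b.1.kind b.2
  | .ue k => g.1 .u k

/-- LOS probability of a link of length `d`. -/
def losProb (p : Params) (d : ℝ) : ℝ := if d ≤ p.dLOS then p.pLOS else 0

/-- Path loss between two nodes. -/
def pathLoss (p : Params) (g : Geo) (x y : Node) : ℝ :=
  (dist (pos g x) (pos g y)) ^
    (if g.2 (.link s(x, y)) < losProb p (dist (pos g x) (pos g y)) then p.alphaL else p.alphaN)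

/-- Biased average received power at `z` from the base station `b`. -/
def assocMetric (p : Params) (g : Geo) (z : Node) (b : BS) : ℝ :=
  p.pow b.1.kind * (pathLoss p g (.bs b) z)⁻¹ * p.gMain b.1.kind * p.bias b.1

/-- The user `z` is associated with the base station `b`. -/
def Serves (p : Params) (g : Geo) (b : BS) (z : Node) : Prop :=
  ∀ b', b' ≠ b → assocMetric p g z b' < assocMetric p g z b

/-- The SBS labelled `x` is connected to the MBS labelled `j`. -/
def Anchors (p : Params) (g : Geo) (j x : ℕ) : Prop :=
  ∀ j', j' ≠ j →
    pathLoss p g (.bs (.m, j)) (.bs (.s, x)) < pathLoss p g (.bs (.m, j')) (.bs (.s, x))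

/-- The `k`-th user is an uplink user (this has probability `1 - η`). -/
def IsUL (p : Params) (g : Geo) (k : ℕ) : Prop := p.eta ≤ g.2 (.dir k)

/-- Law of the gain of an interfering link between devices of kinds `κ₁` and `κ₂`. -/
def gainLaw (p : Params) (κ₁ κ₂ : Kind) : Measure ℝ :=
  let a := p.beam κ₁ / (2 * Real.pi)
  let b := p.beam κ₂ / (2 * Real.pi)
  ENNReal.ofReal (a * b) • Measure.dirac (p.gMain κ₁ * p.gMain κ₂)
    + ENNReal.ofReal (a * (1 - b)) • Measure.dirac (p.gMain κ₁ * p.gSide κ₂)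
    + ENNReal.ofReal ((1 - a) * b) • Measure.dirac (p.gSide κ₁ * p.gMain κ₂)
    + ENNReal.ofReal ((1 - a) * (1 - b)) • Measure.dirac (p.gSide κ₁ * p.gSide κ₂)

/-- The laws of the locations, of the fading and of the antenna gains. Fading and gains of one
link are functions of the slot, arbitrarily correlated over the slots. -/
structure Env (p : Params) where
  /-- laws of the three point processes -/
  points : Kind → Measure (ℕ → Pos)
  points_prob : ∀ κ, IsProbabilityMeasure (points κ)
  points_ppp : ∀ κ, IsPPP (p.lam κ) (points κ)
  /-- law of the fading of a link over the slots -/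
  fading : Measure (ℕ → ℝ)
  fading_prob : IsProbabilityMeasure fading
  fading_exp : ∀ i, fading.map (fun h => h i) = expMeasure 1
  /-- law of the gain of an interfering link over the slots -/
  gain : Kind → Kind → Measure (ℕ → ℝ)
  gain_prob : ∀ κ₁ κ₂, IsProbabilityMeasure (gain κ₁ κ₂)
  gain_law : ∀ κ₁ κ₂ i, (gain κ₁ κ₂).map (fun h => h i) = gainLaw p κ₁ κ₂

attribute [instance] Env.points_prob Env.fading_prob Env.gain_prob

/-- Law of the spatial configuration: independent Poisson point processes, independent links,
independent user types. -/
def geoLaw {p : Params} (E : Env p) : Measure Geo :=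
  (Measure.infinitePi E.points).prod (coins GeoCoin)

instance {p : Params} (E : Env p) : IsProbabilityMeasure (geoLaw E) := by
  unfold geoLaw; infer_instance

/-- The probability `𝒜_t` that the typical user associates with a base station of tier `t`. -/
def assoc {p : Params} (E : Env p) (t : Tier) : ℝ≥0∞ :=
  geoLaw E {g | ∃ k, Serves p g (t, k) .user0}

/-! ### Loads -/

/-- Load PMF `κ` of a typical base station with mean load `ε`. -/
def kappa (ε : ℝ) (n : ℕ) : ℝ :=
  (3.5 : ℝ) ^ (3.5 : ℝ) * Real.Gamma (n + 3.5) * ε ^ n * (3.5 + ε) ^ (-(n : ℝ) - 3.5)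
    / (n.factorial * Real.Gamma 3.5)

/-- Load PMF `κ*` of a tagged base station, carried by `n ≥ 1`. -/
def kappaStar (ε : ℝ) (n : ℕ) : ℝ :=
  if n = 0 then 0 else
    (3.5 : ℝ) ^ (3.5 : ℝ) * Real.Gamma (n + 3.5) * ε ^ (n - 1) * (3.5 + ε) ^ (-(n : ℝ) - 3.5)
      / ((n - 1).factorial * Real.Gamma 3.5)

/-- Mean number of users of a typical base station of tier `t`. -/
def meanLoad {p : Params} (E : Env p) (t : Tier) : ℝ :=
  p.lam .u * (assoc E t).toReal / p.lam t.kind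

/-- Joint PMF `Υ_t(n₁, n₂, k)` of the numbers of uplink and downlink users. -/
def upsilon {p : Params} (E : Env p) (t : Tier) (n₁ n₂ : ℕ) (k : ℝ) : ℝ :=
  (3.5 : ℝ) ^ (3.5 : ℝ) / Real.Gamma 3.5
    * (p.eta ^ n₂ * (1 - p.eta) ^ n₁ / (n₁.factorial * n₂.factorial))
    * (Real.Gamma (n₁ + n₂ + k)
        / (meanLoad E t ^ k * (1 + 3.5 / meanLoad E t) ^ ((n₁ : ℝ) + n₂ + k)))

/-- Mean number of uplink users of a typical SBS. -/
def meanUL {p : Params} (E : Env p) : ℝ :=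
  (1 - p.eta) * p.lam .u * (assoc E .s).toReal / p.lam .s

/-- Mean number of SBSs with at least one uplink user of a typical MBS. -/
def meanActiveSBS {p : Params} (E : Env p) : ℝ :=
  p.lam .s * (1 - (1 + (assoc E .s).toReal * p.lam .u * (1 - p.eta) / (3.5 * p.lam .s))
    ^ (-3.5 : ℝ)) / p.lam .m

/-- The load laws of the independent load model. For users, the pair is (uplink, downlink); for
the tagged base station it does not count the typical user. -/
structure Loads {p : Params} (E : Env p) where
  users : Tier → Measure (ℕ × ℕ)
  users_prob : ∀ t, IsProbabilityMeasure (users t)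
  users_pmf : ∀ t n₁ n₂, users t {(n₁, n₂)} = ENNReal.ofReal (upsilon E t n₁ n₂ 3.5)
  tagUsers : Tier → Measure (ℕ × ℕ)
  tagUsers_prob : ∀ t, IsProbabilityMeasure (tagUsers t)
  tagUsers_pmf : ∀ t n₁ n₂, tagUsers t {(n₁, n₂)} = ENNReal.ofReal (upsilon E t n₁ n₂ 4.5)
  /-- number of SBSs with at least one uplink user connected to a typical MBS -/
  sbs : Measure ℕ
  sbs_prob : IsProbabilityMeasure sbs
  sbs_pmf : ∀ n, sbs {n} = ENNReal.ofReal (kappa (meanActiveSBS E) n)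
  /-- the same for the MBS serving the tagged SBS -/
  tagSBS : Measure ℕ
  tagSBS_prob : IsProbabilityMeasure tagSBS
  tagSBS_pmf : ∀ n, tagSBS {n} = ENNReal.ofReal (kappaStar (meanActiveSBS E) n)

attribute [instance] Loads.users_prob Loads.tagUsers_prob Loads.sbs_prob Loads.tagSBS_prob

/-- Load marks of the base stations: numbers of (uplink, downlink) users of each base station,
and for each MBS the number of its SBSs with at least one uplink user. -/
abbrev Marks := (BS → ℕ × ℕ) × (ℕ → ℕ)

/-- Loads of the tagged base stations: users of the base station serving the typical user
(apart from the typical user), according to its tier, and number of SBSs with at least one uplink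
user of the MBS that serves the tagged SBS. -/
abbrev TagLoads := (Tier → ℕ × ℕ) × ℕ

def marksLaw {p : Params} {E : Env p} (Λ : Loads E) : Measure Marks :=
  (Measure.infinitePi fun b : BS => Λ.users b.1).prod (Measure.infinitePi fun _ : ℕ => Λ.sbs)

instance {p : Params} {E : Env p} (Λ : Loads E) : IsProbabilityMeasure (marksLaw Λ) := by
  unfold marksLaw; infer_instance

def tagLoadsLaw {p : Params} {E : Env p} (Λ : Loads E) : Measure TagLoads :=
  (Measure.infinitePi Λ.tagUsers).prod Λ.tagSBS

instance {p : Params} {E : Env p} (Λ : Loads E) : IsProbabilityMeasure (tagLoadsLaw Λ) := by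
  unfold tagLoadsLaw; infer_instance

/-! ### Temporally varying randomness -/

/-- Labels of the temporal uniform variables: rounding variable of each base station; in each
slot, priority of each user, priority of each SBS, and poaching decision of each SBS. -/
inductive TempCoin
  | round (b : BS)
  | uePrio (i k : ℕ)
  | sbsPrio (i k : ℕ)
  | poach (i k : ℕ)

/-- Fading and interference gain of each pair (receiver, transmitter) in each slot, and the
temporal uniform variables. -/
abbrev Temp := (Node × Node → ℕ → ℝ) × (Node × Node → ℕ → ℝ) × (TempCoin → ℝ)

def tempLaw {p : Params} (E : Env p) : Measure Temp :=
  (Measure.infinitePi fun _ : Node × Node => E.fading).prod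
    ((Measure.infinitePi fun e : Node × Node => E.gain e.1.kind e.2.kind).prod (coins TempCoin))

instance {p : Params} (E : Env p) : IsProbabilityMeasure (tempLaw E) := by
  unfold tempLaw; infer_instance

/-- Labels of the uniform variables of the tagged base stations: rounding; and, in each slot,
choice of the user to serve on the access link, choice of the SBS by the tagged MBS, poaching
decision of the tagged SBS, and choice of the user whose data the tagged SBS forwards. -/
inductive TagCoin
  | round
  | ue (i : ℕ)
  | sbs (i : ℕ)
  | poach (i : ℕ)
  | data (i : ℕ)

/-! ### Interference and SINR -/

section SINR

variable (p : Params) (w : AccessScheme) (wb : BackhaulScheme) (f : Frame) (i : ℕ)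
  (g : Geo) (mk : Marks) (tm : Temp)

/-- Power received at `z` in slot `i` from the interfering node `y`. -/
def interf (z y : Node) : ℝ≥0∞ :=
  ENNReal.ofReal (p.c0 * p.pow y.kind * tm.1 (z, y) i * tm.2.1 (z, y) i)
    / ENNReal.ofReal (pathLoss p g z y)

/-- Power received at `z` in slot `i` from the desired transmitter `y`. -/
def signal (z y : Node) : ℝ≥0∞ :=
  ENNReal.ofReal (p.c0 * p.pow y.kind * tm.1 (z, y) i * (p.gMain y.kind * p.gMain z.kind))
    / ENNReal.ofReal (pathLoss p g z y)

/-- The `k`-th user is the uplink user scheduled by the base station `b` in slot `i`. -/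
def SchedUE (b : BS) (k : ℕ) : Prop :=
  Winner (fun k => Serves p g b (.ue k) ∧ IsUL p g k) (fun k => tm.2.2 (.uePrio i k)) k

/-- Power received at `z` in slot `i` from the uplink user scheduled by `b`. -/
def interfUE (z : Node) (b : BS) : ℝ≥0∞ :=
  ∑' k, ind (SchedUE p i g tm b k) * interf p i g tm z (.ue k)

/-- Number of downlink access slots of the base station `b`. -/
def fad (b : BS) : ℕ := fadOf w f (mk.1 b).1 (mk.1 b).2 (tm.2.2 (.round b))

/-- Interference at the base station `b` in a slot `i` of the access subframe: from base stations
that are in their downlink part, and from users served by base stations in their uplink part. -/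
def accessInterf (b : BS) : ℝ≥0∞ :=
  ∑' y : BS, ind (y ≠ b) *
    (ind (i ≤ fad w f mk tm y ∧ 0 < (mk.1 y).2) * interf p i g tm (.bs b) (.bs y)
      + ind (fad w f mk tm y < i ∧ i ≤ f.Fa ∧ 0 < (mk.1 y).1) * interfUE p i g tm (.bs b) y)

/-- SINR of the typical uplink user at `b` in a slot `i` of the access subframe. -/
def sinrAccess (b : BS) : ℝ≥0∞ :=
  signal p i g tm (.bs b) .user0 / (accessInterf p w f i g mk tm b + ENNReal.ofReal p.sigma2)

/-- The MBS `j'` schedules the SBS `y` in the uplink backhaul slot `i`, where `x` is the tagged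
SBS, `j` is its MBS, and `r` tells whether `j` schedules `x`. A MBS chooses uniformly from its SBSs
with at least one uplink user. -/
def SchedSBS (j x : ℕ) (r : Prop) (j' y : ℕ) : Prop :=
  (j' = j ∧ r ∧ y = x) ∨
  (j' = j ∧ ¬ r ∧ Winner (fun y => Anchors p g j y ∧ y ≠ x ∧ 0 < (mk.1 (.s, y)).1)
    (fun y => tm.2.2 (.sbsPrio i y)) y) ∨
  (j' ≠ j ∧ 0 < mk.2 j' ∧ Winner (fun y => Anchors p g j' y ∧ y ≠ x ∧ 0 < (mk.1 (.s, y)).1)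
    (fun y => tm.2.2 (.sbsPrio i y)) y)

/-- Interference at `z` in the uplink backhaul slot `i` from uplink users that are served in
poached slots by SBSs other than the tagged one. -/
def poachInterf (j x : ℕ) (r : Prop) (z : Node) : ℝ≥0∞ :=
  ind (wb = .UAB) * ∑' y : ℕ,
    ind (y ≠ x ∧ 0 < (mk.1 (.s, y)).1 ∧ (¬ ∃ j', SchedSBS p i g mk tm j x r j' y)
      ∧ tm.2.2 (.poach i y) < p.pul) * interfUE p i g tm z (.s, y)

/-- SINR of the typical uplink user at the tagged SBS `x` in an uplink backhaul slot `i` that is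
poached by `x`; here `x` is not scheduled by its MBS `j`, and the scheme is `UAB`. -/
def sinrPoach (j x : ℕ) : ℝ≥0∞ :=
  signal p i g tm (.bs (.s, x)) .user0 /
    ((∑' j' : ℕ, ∑' y : ℕ, ind (SchedSBS p i g mk tm j x False j' y)
        * interf p i g tm (.bs (.s, x)) (.bs (.s, y)))
      + poachInterf p .UAB i g mk tm j x False (.bs (.s, x)) + ENNReal.ofReal p.sigma2)

/-- SINR of the backhaul link from the tagged SBS `x` to its MBS `j` in an uplink backhaul slot
`i` in which `j` schedules `x`. -/
def sinrBackhaul (j x : ℕ) : ℝ≥0∞ :=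
  signal p i g tm (.bs (.m, j)) (.bs (.s, x)) /
    ((∑' j' : ℕ, ∑' y : ℕ, ind (j' ≠ j ∧ SchedSBS p i g mk tm j x True j' y)
        * interf p i g tm (.bs (.m, j)) (.bs (.s, y)))
      + poachInterf p wb i g mk tm j x True (.bs (.m, j)) + ENNReal.ofReal p.sigma2)

end SINR

/-! ### SINR coverage -/

section Coverage

variable {p : Params} {E : Env p} (Λ : Loads E)

/-- Law of everything that determines the SINR, for given shared subframe lengths. -/
def netLaw : Measure (Geo × Marks × Temp) :=
  (geoLaw E).prod ((marksLaw Λ).prod (tempLaw E))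

/-- Coverage of the access link in an access slot, given that the typical user is associated with
tier `t`. -/
def covAccess (w : AccessScheme) (f : Frame) (t : Tier) (i : ℕ) (τ : ℝ) : ℝ≥0∞ :=
  netLaw Λ {ω | ∃ k, Serves p ω.1 (t, k) .user0 ∧
    ENNReal.ofReal τ < sinrAccess p w f i ω.1 ω.2.1 ω.2.2 (t, k)} / assoc E t

/-- Coverage of the access link in a poached backhaul slot, given that the typical user is
associated with an SBS. -/
def covPoach (i : ℕ) (τ : ℝ) : ℝ≥0∞ :=
  netLaw Λ {ω | ∃ x j, Serves p ω.1 (.s, x) .user0 ∧ Anchors p ω.1 j x ∧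
    ENNReal.ofReal τ < sinrPoach p i ω.1 ω.2.1 ω.2.2 j x} / assoc E .s

/-- Coverage of the backhaul link, given that the typical user is associated with an SBS. -/
def covBackhaul (wb : BackhaulScheme) (i : ℕ) (τ : ℝ) : ℝ≥0∞ :=
  netLaw Λ {ω | ∃ x j, Serves p ω.1 (.s, x) .user0 ∧ Anchors p ω.1 j x ∧
    ENNReal.ofReal τ < sinrBackhaul p wb i ω.1 ω.2.1 ω.2.2 j x} / assoc E .s

end Coverage

/-! ### Data transmitted in a frame and mean rates of the model -/

/-- Spatial randomness: points, blockage, user types, loads. -/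
abbrev Spatial := Geo × Marks × TagLoads

/-- Temporal randomness, apart from the shared subframe lengths. -/
abbrev Temporal := Temp × (TagCoin → ℝ)

section Data

variable (p : Params) (w : AccessScheme) (wb : BackhaulScheme) (f : Frame)
  (s : Spatial) (θ : Temporal)

/-- Number of downlink access slots of the base station that serves the typical user, if this
base station has tier `t`. Its number of uplink users includes the typical user. -/
def tagFad (t : Tier) : ℕ :=
  fadOf w f ((s.2.2.1 t).1 + 1) (s.2.2.1 t).2 (θ.2 .round)

/-- Among the uplink users of the tagged base station, of tier `t`, a uniformly random one is
chosen: it is the typical user. The choice is made with the uniform variable `c`. -/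
def Chosen (t : Tier) (c : TagCoin) : Prop := θ.2 c * ((s.2.2.1 t).1 + 1) < 1

/-- The tagged SBS is scheduled by its MBS in the uplink backhaul slot `i`. -/
def TagSBSSched (i : ℕ) : Prop := θ.2 (.sbs i) * s.2.2.2 < 1

/-- Data that the typical uplink user transmits in the access subframe of a frame to a base
station of tier `t`; zero if it is not associated with tier `t`. -/
def dataSubframe (t : Tier) : ℝ≥0∞ :=
  ENNReal.ofReal (p.W * p.T) * ∑ i ∈ Finset.Ioc (tagFad w f s θ t) f.Fa,
    ∑' k : ℕ, ind (Serves p s.1 (t, k) .user0 ∧ Chosen s θ t (.ue i))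
      * log2p (sinrAccess p w f i s.1 s.2.1 θ.1 (t, k))

/-- Data transmitted on the access link in poached uplink backhaul slots. -/
def dataPoach : ℝ≥0∞ :=
  ENNReal.ofReal (p.W * p.T) * ∑ i ∈ Finset.Ioc (f.Fa + f.Fbd) p.F,
    ∑' x : ℕ, ∑' j : ℕ, ind (Serves p s.1 (.s, x) .user0 ∧ Anchors p s.1 j x
        ∧ ¬ TagSBSSched s θ i ∧ θ.2 (.poach i) < p.pul ∧ Chosen s θ .s (.ue i))
      * log2p (sinrPoach p i s.1 s.2.1 θ.1 j x)

/-- Data transmitted to an SBS on the access link in a frame. -/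
def dataAccess : ℝ≥0∞ := dataSubframe p w f s θ .s + ind (wb = .UAB) * dataPoach p f s θ

/-- Data of the typical user that its SBS transmits on the backhaul link in a frame. -/
def dataBackhaul : ℝ≥0∞ :=
  ENNReal.ofReal (p.W * p.T) * ∑ i ∈ Finset.Ioc (f.Fa + f.Fbd) p.F,
    ∑' x : ℕ, ∑' j : ℕ, ind (Serves p s.1 (.s, x) .user0 ∧ Anchors p s.1 j x
        ∧ TagSBSSched s θ i ∧ Chosen s θ .s (.data i))
      * log2p (sinrBackhaul p wb i s.1 s.2.1 θ.1 j x)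

end Data

section Rates

variable {p : Params} {E : Env p} (Λ : Loads E) (w : AccessScheme) (wb : BackhaulScheme)

def spatialLaw : Measure Spatial := (geoLaw E).prod ((marksLaw Λ).prod (tagLoadsLaw Λ))

def temporalLaw (E : Env p) : Measure Temporal := (tempLaw E).prod (coins TagCoin)

/-- Mean data per frame to the serving MBS, given the shared subframe lengths and that the
typical user is associated with an MBS. -/
def meanDataMBS (f : Frame) : ℝ≥0∞ :=
  (∫⁻ s, ∫⁻ θ, dataSubframe p w f s θ .m ∂temporalLaw E ∂spatialLaw Λ) / assoc E .m

/-- Mean data per frame on the access link, given the shared subframe lengths and that the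
typical user is associated with an SBS. -/
def meanDataAccess (f : Frame) : ℝ≥0∞ :=
  (∫⁻ s, ∫⁻ θ, dataAccess p w wb f s θ ∂temporalLaw E ∂spatialLaw Λ) / assoc E .s

/-- Mean data per frame on the backhaul link, given the shared subframe lengths and that the
typical user is associated with an SBS. -/
def meanDataBackhaul (f : Frame) : ℝ≥0∞ :=
  (∫⁻ s, ∫⁻ θ, dataBackhaul p wb f s θ ∂temporalLaw E ∂spatialLaw Λ) / assoc E .s

/-- Slot duration times number of slots: the duration of a frame. -/
def frameTime (p : Params) : ℝ≥0∞ := ENNReal.ofReal (p.T * p.F)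

/-- Mean rate of a typical uplink user that is associated with an MBS. -/
def meanRateMBS : ℝ≥0∞ := frameMean p (meanDataMBS Λ w) / frameTime p

/-- Approximate mean rate of a typical uplink user that is associated with an SBS: the mean of the
minimum is replaced by the minimum of the means of the access and backhaul data of a frame. -/
def approxRateSBS : ℝ≥0∞ :=
  frameMean p (fun f => min (meanDataAccess Λ w wb f) (meanDataBackhaul Λ wb f)) / frameTime p

/-- Exact mean rate of a typical uplink user that is associated with an SBS: spatial mean of the
minimum of the temporal mean rates on the access and the backhaul link. -/
def exactRateSBS : ℝ≥0∞ :=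
  (∫⁻ s, min (frameMean p fun f => ∫⁻ θ, dataAccess p w wb f s θ ∂temporalLaw E)
      (frameMean p fun f => ∫⁻ θ, dataBackhaul p wb f s θ ∂temporalLaw E) ∂spatialLaw Λ)
    / assoc E .s / frameTime p

/-- Approximate mean rate of a typical uplink user. -/
def approxMeanRate : ℝ≥0∞ :=
  assoc E .m * meanRateMBS Λ w + assoc E .s * approxRateSBS Λ w wb

/-- Exact mean rate of a typical uplink user. -/
def exactMeanRate : ℝ≥0∞ :=
  assoc E .m * meanRateMBS Λ w + assoc E .s * exactRateSBS Λ w wb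

/-! ### The rate formulas -/

/-- Spectral efficiency `(1 / ln 2) ∫₀^∞ S(τ) / (1 + τ) dτ` for a coverage function `S`. -/
def specEff (S : ℝ → ℝ≥0∞) : ℝ≥0∞ :=
  ENNReal.ofReal (1 / Real.log 2) * ∫⁻ τ in Set.Ioi (0 : ℝ), S τ / ENNReal.ofReal (1 + τ)

/-- Average over the load of a tagged base station of tier `t` of the spectral efficiency in the
uplink part of its access subframe. -/
def accessTerm (t : Tier) (f : Frame) : ℝ≥0∞ :=
  ∑' n₁ : ℕ, ∑' n₂ : ℕ, ENNReal.ofReal (upsilon E t n₁ n₂ 4.5 / (n₁ + 1)) *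
    fadMean w f (n₁ + 1) n₂ fun Fad =>
      specEff fun τ => ∑ i ∈ Finset.Ioc Fad f.Fa, covAccess Λ w f t i τ

/-- The mean `E[1 / N_{s,u}]` for the tagged MBS. -/
def invActive (E : Env p) : ℝ≥0∞ :=
  ∑' n : ℕ, ENNReal.ofReal (kappaStar (meanActiveSBS E) n / n)

/-- The sum `∑_{n ≥ 1} κ*_{u,s}(n) / n`. -/
def invUL (E : Env p) : ℝ≥0∞ := ∑' n : ℕ, ENNReal.ofReal (kappaStar (meanUL E) n / n)

/-- Formula for the mean rate of users associated with an MBS. -/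
def formulaM : ℝ≥0∞ :=
  frameMean p fun f => ENNReal.ofReal (p.W / p.F) * accessTerm Λ w .m f

/-- Formula for the access rate of users associated with an SBS. -/
def formulaA (f : Frame) : ℝ≥0∞ :=
  ENNReal.ofReal p.W * accessTerm Λ w .s f
    + ind (wb = .UAB) * (ENNReal.ofReal p.W * (1 - invActive E) * ENNReal.ofReal p.pul * invUL E
        * specEff fun τ => ∑ i ∈ Finset.Ioc (f.Fa + f.Fbd) p.F, covPoach Λ i τ)

/-- Formula for the backhaul rate of users associated with an SBS. -/
def formulaB (f : Frame) : ℝ≥0∞ :=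
  ENNReal.ofReal p.W * invActive E * invUL E
    * specEff fun τ => ∑ i ∈ Finset.Ioc (f.Fa + f.Fbd) p.F, covBackhaul Λ wb i τ

/-- Formula for the approximate mean rate of users associated with an SBS. -/
def formulaS : ℝ≥0∞ :=
  frameMean p fun f => min (formulaA Λ w wb f) (formulaB Λ wb f) / p.F

end Rates

end

end MmWave

open MmWave

namespace MmWave

/-! ### Negative binomial series -/

/-! In each slot, the data of the typical user is a product of two factors. A 0-1 weight says
whether the user is scheduled; it depends only on the tagged loads and tagged coins. A logarithmic
term depends only on the geometry, the load marks and the fading, gains and coins of the network.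
The law of the model is a product measure, so the mean of the product is the product of the means
(`lintegral_separate`); the `data..._eq` lemmas put the data of a frame in this form.

The mean of the logarithmic term comes from `log2 (1 + X) = (1 / ln 2) ∫ 1(τ < X) / (1 + τ) dτ` and
Tonelli. Since a user has at most one server and an SBS at most one MBS, the sums over base stations
have at most one nonzero term, and integrating it gives the coverage probability
(`lintegral_tsum_ind_mul_log2p`, `specEff_covAccess`, `specEff_covPoach`, `specEff_covBackhaul`).

The mean weights are computed from the load laws (`lintegral_accessWeight`, `lintegral_poachWeight`,
`lintegral_backhaulWeight`). In access slots both user counts remain, because the number of downlink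
slots may depend on both. In backhaul slots only the uplink count matters, and summing `upsilon`
over the downlink count by the negative binomial series gives `kappaStar` at the mean uplink load
(`hasSum_upsilon`).

This yields the mean data for every fixed frame. The frame average is a finite nonnegative
combination, so it passes through constants and integrals. The upper bound on the exact rate uses
only that the integral of a minimum is at most the minimum of the integrals. All quantities live in
`ℝ≥0∞`, so no integrability is needed, only measurability. -/

lemma gamma_add_nat_eq_multichoose {a : ℝ} (ha : 0 < a) (n : ℕ) :
    Real.Gamma (a + n) = Real.Gamma a * (n.factorial * Ring.multichoose a n) := by
  have h := Ring.factorial_nsmul_multichoose_eq_ascPochhammer a n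
  rw [nsmul_eq_mul] at h
  rw [h]
  clear h
  induction n with
  | zero => simp
  | succ n ih =>
    have : (a + ((n + 1 : ℕ) : ℝ)) = (a + n) + 1 := by push_cast; ring
    rw [this, Real.Gamma_add_one (by positivity), ih, Polynomial.ascPochhammer_smeval_eq_eval,
      Polynomial.ascPochhammer_smeval_eq_eval, ascPochhammer_succ_right]
    simp
    ring

/-- The binomial series of `(1 - x) ^ (-a)`, whose coefficients are rising factorials of `a` over
`n!`, that is, Gamma quotients. It serves to sum out the downlink users in `hasSum_upsilon`. -/
lemma hasSum_gamma_mul_pow_div_factorial {a x : ℝ} (ha : 0 < a) (hx : |x| < 1) :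
    HasSum (fun n : ℕ => Real.Gamma (a + n) * x ^ n / n.factorial)
      (Real.Gamma a * (1 - x) ^ (-a)) := by
  have h := (Real.one_div_one_sub_rpow_hasFPowerSeriesOnBall_zero a).hasSum (y := x)
    (by simpa [enorm_eq_nnnorm] using! hx)
  have hx1 : 0 ≤ 1 - x := by linarith [(abs_lt.mp hx).2]
  have h2 := h.mul_left (Real.Gamma a)
  simp only [zero_add] at h2
  rw [Real.rpow_neg hx1, ← one_div]
  have hfun : (fun n : ℕ => Real.Gamma (a + n) * x ^ n / n.factorial) = fun n => Real.Gamma a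
      * (FormalMultilinearSeries.ofScalars ℝ (fun n : ℕ => Ring.choose (a + n - 1) n) n)
        fun _ => x := by
    funext n
    -- `Ring.choose r n` is `Ring.multichoose (r - n + 1) n`, and here `r - n + 1 = a`.
    have : Ring.choose (a + n - 1) n = Ring.multichoose a n := by
      rw [Ring.choose]; congr 1; ring
    rw [gamma_add_nat_eq_multichoose ha, FormalMultilinearSeries.ofScalars_apply_eq, this,
      smul_eq_mul]
    field_simp
  rw [hfun]
  exact h2

/-! ### Uniform variables and randomized rounding -/

/-- No lower bound on `a` is needed: for negative `a` both sides vanish, since `ENNReal.ofReal`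
truncates. -/
lemma unif_Iio {a : ℝ} (ha : a ≤ 1) : unif (Set.Iio a) = ENNReal.ofReal a := by
  rw [unif, Measure.restrict_apply measurableSet_Iio]
  have : Set.Iio a ∩ Set.Icc 0 1 = Set.Ico 0 a := by
    ext x; simp only [Set.mem_inter_iff, Set.mem_Iio, Set.mem_Icc, Set.mem_Ico]
    constructor
    · rintro ⟨h1, h2, h3⟩; exact ⟨h2, h1⟩
    · rintro ⟨h1, h2⟩; exact ⟨h2, h1, by linarith⟩
  rw [this]; simp

lemma unif_Ici {a : ℝ} (h0 : 0 ≤ a) (ha : a ≤ 1) :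
    unif (Set.Ici a) = ENNReal.ofReal (1 - a) := by
  rw [← Set.compl_Iio, prob_compl_eq_one_sub measurableSet_Iio, unif_Iio ha,
    ENNReal.ofReal_sub _ h0, ENNReal.ofReal_one]

/-- A uniform variable is below `1 / n` with probability `1 / n`. -/
lemma unif_mul_lt_one {n : ℝ} (hn : 1 ≤ n) :
    unif {u | u * n < 1} = ENNReal.ofReal (1 / n) := by
  have : {u : ℝ | u * n < 1} = Set.Iio (1 / n) := by
    ext u; exact (lt_div_iff₀ (by linarith : (0 : ℝ) < n)).symm
  rw [this, unif_Iio]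
  rw [div_le_one (by linarith)]; exact hn

lemma measurable_randRound (x : ℝ) : Measurable (randRound x) :=
  Measurable.ite measurableSet_Iio measurable_const measurable_const

lemma lintegral_randRound (x : ℝ) (g : ℕ → ℝ≥0∞) :
    ∫⁻ u, g (randRound x u) ∂unif = roundMean x g := by
  have h : ∀ u, g (randRound x u) = (Set.Iio (Int.fract x)).indicator (fun _ => g ⌈x⌉₊) u
      + (Set.Ici (Int.fract x)).indicator (fun _ => g ⌊x⌋₊) u := by
    intro u
    unfold randRound
    by_cases hu : u < Int.fract x
    · simp [hu, not_le.mpr hu]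
    · simp [hu, not_lt.mp hu]
  simp_rw [h]
  rw [lintegral_add_left (measurable_const.indicator measurableSet_Iio),
    lintegral_indicator_const measurableSet_Iio, lintegral_indicator_const measurableSet_Ici,
    unif_Iio (Int.fract_lt_one x).le, unif_Ici (Int.fract_nonneg x) (Int.fract_lt_one x).le,
    roundMean, mul_comm, mul_comm (g ⌊x⌋₊)]

lemma measurable_fadOf (w : AccessScheme) (f : Frame) (nu nd : ℕ) :
    Measurable (fadOf w f nu nd) := by
  cases w
  · exact measurable_const
  · exact measurable_randRound _

lemma lintegral_fadOf (w : AccessScheme) (f : Frame) (nu nd : ℕ) (g : ℕ → ℝ≥0∞) :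
    ∫⁻ u, g (fadOf w f nu nd u) ∂unif = fadMean w f nu nd g := by
  cases w
  · simp [fadOf, fadMean]
  · exact lintegral_randRound _ _

/-! ### Indicators and the logarithmic layer cake formula -/

lemma ind_true {P : Prop} (h : P) : ind P = 1 := if_pos h

lemma ind_false {P : Prop} (h : ¬ P) : ind P = 0 := if_neg h

lemma ind_and (P Q : Prop) : ind (P ∧ Q) = ind P * ind Q := by
  by_cases hP : P <;> by_cases hQ : Q <;> simp [ind, hP, hQ]

lemma measurable_ind {Ω : Type*} [MeasurableSpace Ω] {P : Ω → Prop}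
    (h : MeasurableSet {ω | P ω}) : Measurable fun ω => ind (P ω) :=
  Measurable.ite h measurable_const measurable_const

lemma lintegral_ind {Ω : Type*} [MeasurableSpace Ω] {μ : Measure Ω} {P : Ω → Prop}
    (h : MeasurableSet {ω | P ω}) : ∫⁻ ω, ind (P ω) ∂μ = μ {ω | P ω} := by
  rw [← lintegral_indicator_one h]
  congr 1

lemma lintegral_Ioo_inv_one_add {x : ℝ} (hx : 0 ≤ x) :
    ∫⁻ τ in Set.Ioo (0 : ℝ) x, (ENNReal.ofReal (1 + τ))⁻¹ = ENNReal.ofReal (Real.log (1 + x)) := by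
  have h1 : ∫⁻ τ in Set.Ioo (0 : ℝ) x, (ENNReal.ofReal (1 + τ))⁻¹
      = ∫⁻ τ in Set.Ioc (0 : ℝ) x, ENNReal.ofReal ((1 + τ)⁻¹) := by
    rw [setLIntegral_congr Ioo_ae_eq_Ioc]
    refine setLIntegral_congr_fun measurableSet_Ioc fun τ hτ => ?_
    rw [ENNReal.ofReal_inv_of_pos (by linarith [hτ.1])]
  have hint : IntegrableOn (fun τ : ℝ => (1 + τ)⁻¹) (Set.Ioc 0 x) := by
    refine (ContinuousOn.integrableOn_Icc ?_).mono_set Set.Ioc_subset_Icc_self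
    exact ContinuousOn.inv₀ (by fun_prop) fun τ hτ => by linarith [hτ.1]
  rw [h1, ← ofReal_integral_eq_lintegral_ofReal hint
    ((ae_restrict_iff' measurableSet_Ioc).mpr (.of_forall fun τ hτ => by
      have := hτ.1; simp; linarith)),
    ← intervalIntegral.integral_of_le hx]
  congr 1
  rw [intervalIntegral.integral_comp_add_left (fun y => y⁻¹) 1,
    integral_inv_of_pos (by norm_num) (by linarith)]
  simp

/-- For finite `x` the integrand is `1 / (1 + τ)` cut off at `x`, with integral `ln (1 + x)`. For `x
= ∞` the integral diverges, in agreement with the value `∞` of `log2p`. -/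
lemma log2p_eq_lintegral (x : ℝ≥0∞) :
    log2p x = ENNReal.ofReal (1 / Real.log 2)
      * ∫⁻ τ in Set.Ioi (0 : ℝ), ind (ENNReal.ofReal τ < x) / ENNReal.ofReal (1 + τ) := by
  have hl : 0 < 1 / Real.log 2 := by have := Real.log_pos (by norm_num : (1 : ℝ) < 2); positivity
  -- Lower bound by truncating the integral at a finite level `y`; it serves the case `x = ∞`.
  have key : ∀ y : ℝ, 0 ≤ y → ENNReal.ofReal y ≤ x →
      ENNReal.ofReal (Real.log (1 + y)) ≤
      ∫⁻ τ in Set.Ioi (0 : ℝ), ind (ENNReal.ofReal τ < x) / ENNReal.ofReal (1 + τ) := by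
    intro y hy hyx
    rw [← lintegral_Ioo_inv_one_add hy]
    calc _ ≤ ∫⁻ τ in Set.Ioo (0 : ℝ) y, ind (ENNReal.ofReal τ < x) / ENNReal.ofReal (1 + τ) := by
          refine setLIntegral_mono' measurableSet_Ioo fun τ hτ => ?_
          rw [ind_true, one_div]
          exact lt_of_lt_of_le ((ENNReal.ofReal_lt_ofReal_iff (hτ.1.trans hτ.2)).mpr hτ.2) hyx
      _ ≤ _ := lintegral_mono_set Set.Ioo_subset_Ioi_self
  by_cases hx : x = ∞
  · rw [log2p, if_pos hx]
    symm
    refine ENNReal.mul_eq_top.mpr (Or.inl ⟨by simpa using hl, ?_⟩)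
    refine ENNReal.eq_top_of_forall_nnreal_le fun r => ?_
    -- The level is chosen so that `ln (1 + y) = r`; the integral thus exceeds every finite bound.
    have := key (Real.exp r - 1) (sub_nonneg.mpr (Real.one_le_exp r.2)) (by simp [hx])
    simpa using this
  · rw [log2p, if_neg hx]
    have h2 : ∫⁻ τ in Set.Ioi (0 : ℝ), ind (ENNReal.ofReal τ < x) / ENNReal.ofReal (1 + τ)
        = ENNReal.ofReal (Real.log (1 + x.toReal)) := by
      rw [← lintegral_Ioo_inv_one_add ENNReal.toReal_nonneg, ← lintegral_indicator measurableSet_Ioi,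
        ← lintegral_indicator measurableSet_Ioo]
      congr 1
      ext τ
      by_cases h0 : 0 < τ
      · rw [Set.indicator_of_mem (Set.mem_Ioi.mpr h0)]
        by_cases h1 : τ < x.toReal
        · rw [Set.indicator_of_mem (Set.mem_Ioo.mpr ⟨h0, h1⟩), ind_true, one_div]
          exact (ENNReal.ofReal_lt_iff_lt_toReal h0.le hx).mpr h1
        · rw [Set.indicator_of_notMem (by simp [h1]), ind_false]
          · simp
          · exact fun h => h1 ((ENNReal.ofReal_lt_iff_lt_toReal h0.le hx).mp h)
      · rw [Set.indicator_of_notMem (by simpa using h0), Set.indicator_of_notMem (by simp [h0])]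
    rw [h2, ← ENNReal.ofReal_mul hl.le, Real.logb]
    congr 1
    ring

lemma measurable_log2p : Measurable log2p :=
  Measurable.ite (measurableSet_singleton _) measurable_const
    (ENNReal.measurable_ofReal.comp (by unfold Real.logb; fun_prop))

/-- Layer cake formula for a random variable observed on one of several disjoint events. -/
lemma lintegral_tsum_ind_mul_log2p {Ω ι : Type*} [MeasurableSpace Ω] [Countable ι]
    {μ : Measure Ω} [SFinite μ] {A : ι → Ω → Prop} {X : ι → Ω → ℝ≥0∞}
    (hA : ∀ k, MeasurableSet {ω | A k ω}) (hX : ∀ k, Measurable (X k))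
    (hdisj : ∀ k l ω, A k ω → A l ω → k = l) :
    ∫⁻ ω, ∑' k, ind (A k ω) * log2p (X k ω) ∂μ
      = specEff fun τ => μ {ω | ∃ k, A k ω ∧ ENNReal.ofReal τ < X k ω} := by
  have hset : MeasurableSet {q : Ω × ℝ | ∃ k, A k q.1 ∧ ENNReal.ofReal q.2 < X k q.1} := by
    rw [Set.ofPred_exists]
    refine MeasurableSet.iUnion fun k => MeasurableSet.inter (measurable_fst (hA k)) ?_
    exact measurableSet_lt (by fun_prop) ((hX k).comp measurable_fst)
  -- By disjointness at most one term of the sum survives, and on its event the existential in the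
  -- coverage set reduces to that index.
  have hpt : ∀ ω, ∑' k, ind (A k ω) * log2p (X k ω) = ENNReal.ofReal (1 / Real.log 2)
      * ∫⁻ τ in Set.Ioi (0 : ℝ),
        ind (∃ k, A k ω ∧ ENNReal.ofReal τ < X k ω) / ENNReal.ofReal (1 + τ) := by
    intro ω
    by_cases h : ∃ k, A k ω
    · obtain ⟨k, hk⟩ := h
      rw [tsum_eq_single k fun l hl => by
        rw [ind_false fun hAl => hl (hdisj _ _ _ hAl hk), zero_mul], ind_true hk, one_mul,
        log2p_eq_lintegral]
      have : ∀ τ, (∃ k, A k ω ∧ ENNReal.ofReal τ < X k ω) ↔ ENNReal.ofReal τ < X k ω := by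
        intro τ
        constructor
        · rintro ⟨l, hl, h⟩; rwa [hdisj l k ω hl hk] at h
        · exact fun h => ⟨k, hk, h⟩
      simp_rw [this]
    · have : ∀ k, ¬ A k ω := fun k hk => h ⟨k, hk⟩
      simp [this, ind_false]
  have hmeas : Measurable fun q : Ω × ℝ =>
      ind (∃ k, A k q.1 ∧ ENNReal.ofReal q.2 < X k q.1) / ENNReal.ofReal (1 + q.2) :=
    (measurable_ind hset).div (by fun_prop)
  simp_rw [hpt]
  rw [lintegral_const_mul _ hmeas.lintegral_prod_right', specEff,
    lintegral_lintegral_swap hmeas.aemeasurable]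
  congr 1
  refine lintegral_congr fun τ => ?_
  have hs : MeasurableSet {ω | ∃ k, A k ω ∧ ENNReal.ofReal τ < X k ω} :=
    hset.preimage (measurable_id.prodMk measurable_const : Measurable fun ω : Ω => (ω, τ))
  simp_rw [div_eq_mul_inv]
  rw [lintegral_mul_const _ (measurable_ind hs), lintegral_ind hs]

/-- Monotonicity in `τ` only supplies measurability. Division is multiplication by `c⁻¹`, so `c = 0`
and `c = ∞` need no separate treatment. -/
lemma specEff_div (S : ℝ → ℝ≥0∞) (hS : Antitone S) (c : ℝ≥0∞) :
    specEff (fun τ => S τ / c) = specEff S / c := by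
  unfold specEff
  have : ∀ τ, S τ / c / ENNReal.ofReal (1 + τ) = S τ / ENNReal.ofReal (1 + τ) * c⁻¹ := by
    intro τ; simp only [div_eq_mul_inv]; ring
  simp_rw [this]
  have hm : Measurable fun τ => S τ / ENNReal.ofReal (1 + τ) := hS.measurable.div (by fun_prop)
  rw [lintegral_mul_const _ hm, ← mul_assoc, div_eq_mul_inv _ c]

lemma specEff_sum {ι : Type*} (s : Finset ι) (S : ι → ℝ → ℝ≥0∞) (hS : ∀ i, Antitone (S i)) :
    specEff (fun τ => ∑ i ∈ s, S i τ) = ∑ i ∈ s, specEff (S i) := by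
  unfold specEff
  have hm : ∀ i ∈ s, Measurable fun τ => S i τ * (ENNReal.ofReal (1 + τ))⁻¹ :=
    fun i _ => (hS i).measurable.mul (by fun_prop)
  simp_rw [div_eq_mul_inv, Finset.sum_mul]
  rw [lintegral_finsetSum s hm, Finset.mul_sum]

/-! ### Measurability -/

/-- Makes `BS` countable, so that quantifiers and sums over base stations preserve measurability. -/
instance : Countable Tier :=
  Function.Injective.countable (f := fun t : Tier => match t with | .m => 0 | .s => (1 : ℕ))
    fun a b h => by cases a <;> cases b <;> simp_all

instance : Countable Node :=
  Function.Injective.countable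
    (f := fun n : Node => match n with
      | .user0 => (Sum.inl () : Unit ⊕ BS ⊕ ℕ)
      | .bs b => .inr (.inl b)
      | .ue k => .inr (.inr k))
    fun a b h => by cases a <;> cases b <;> simp_all

/-- Events are treated as measurable maps into `Prop`, so that measurability proofs follow the
logical structure of the scheduling rules. -/
lemma measurable_lt_prop {Ω α : Type*} [MeasurableSpace Ω] [LinearOrder α] [TopologicalSpace α]
    [OrderClosedTopology α] [SecondCountableTopology α] [MeasurableSpace α]
    [OpensMeasurableSpace α] {f g : Ω → α} (hf : Measurable f) (hg : Measurable g) :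
    Measurable fun ω => f ω < g ω :=
  measurableSet_setOfPred.mp (measurableSet_lt hf hg)

lemma measurable_le_prop {Ω α : Type*} [MeasurableSpace Ω] [LinearOrder α] [TopologicalSpace α]
    [OrderClosedTopology α] [SecondCountableTopology α] [MeasurableSpace α]
    [OpensMeasurableSpace α] {f g : Ω → α} (hf : Measurable f) (hg : Measurable g) :
    Measurable fun ω => f ω ≤ g ω :=
  measurableSet_setOfPred.mp (measurableSet_le hf hg)

lemma measurable_ind_prop {Ω : Type*} [MeasurableSpace Ω] {P : Ω → Prop} (h : Measurable P) :
    Measurable fun ω => ind (P ω) :=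
  measurable_ind (measurableSet_setOfPred.mpr h)

lemma measurable_winner {Ω : Type*} [MeasurableSpace Ω] {C : Ω → ℕ → Prop} {prio : Ω → ℕ → ℝ}
    (hC : ∀ k, Measurable fun ω => C ω k) (hprio : ∀ k, Measurable fun ω => prio ω k) (y : ℕ) :
    Measurable fun ω => Winner (C ω) (prio ω) y :=
  (hC y).and <| Measurable.forall fun y' => measurable_const.imp <|
    (hC y').imp (measurable_lt_prop (hprio y) (hprio y'))

/-- Loads are countable, so joint measurability reduces to each fixed load. The shift `c` is 0 for
an ordinary base station and 1 for the tagged one, whose load mark omits the typical user. -/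
lemma measurable_fadOf_add (w : AccessScheme) (f : Frame) (c : ℕ) :
    Measurable fun q : (ℕ × ℕ) × ℝ => fadOf w f (q.1.1 + c) q.1.2 q.2 :=
  measurable_from_prod_countable_right fun n => measurable_fadOf w f (n.1 + c) n.2

section Geometry

variable (p : Params)

lemma measurable_pos (x : Node) : Measurable fun g : Geo => pos g x := by
  cases x <;> simp only [pos] <;> fun_prop

lemma measurable_losProb : Measurable (losProb p) :=
  Measurable.ite measurableSet_Iic measurable_const measurable_const

lemma measurable_pathLoss (x y : Node) : Measurable fun g : Geo => pathLoss p g x y := by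
  have hd : Measurable fun g : Geo => dist (pos g x) (pos g y) :=
    (measurable_pos x).dist (measurable_pos y)
  refine hd.pow (Measurable.ite (measurableSet_lt ?_ ((measurable_losProb p).comp hd))
    measurable_const measurable_const)
  fun_prop

lemma measurable_assocMetric (z : Node) (b : BS) :
    Measurable fun g : Geo => assocMetric p g z b := by
  have := measurable_pathLoss p (.bs b) z
  unfold assocMetric
  fun_prop

lemma measurable_serves (b : BS) (z : Node) : Measurable fun g : Geo => Serves p g b z :=
  Measurable.forall fun b' => measurable_const.imp <|
    measurable_lt_prop (measurable_assocMetric p z b') (measurable_assocMetric p z b)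

lemma measurable_anchors (j x : ℕ) : Measurable fun g : Geo => Anchors p g j x :=
  Measurable.forall fun _ => measurable_const.imp <|
    measurable_lt_prop (measurable_pathLoss p _ _) (measurable_pathLoss p _ _)

lemma measurable_isUL (k : ℕ) : Measurable fun g : Geo => IsUL p g k :=
  measurable_le_prop measurable_const (by fun_prop)

/-- Association demands a strict maximum, so ties give no server at all. Together with
`Anchors.unique` this provides the disjointness that the layer cake formula needs. -/
lemma Serves.unique {p : Params} {g : Geo} {z : Node} {b b' : BS} (h : Serves p g b z)
    (h' : Serves p g b' z) : b = b' := by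
  by_contra hne
  exact lt_asymm (h b' (Ne.symm hne)) (h' b hne)

lemma Anchors.unique {p : Params} {g : Geo} {x j j' : ℕ} (h : Anchors p g j x)
    (h' : Anchors p g j' x) : j = j' := by
  by_contra hne
  exact lt_asymm (h j' (Ne.symm hne)) (h' j hne)

end Geometry

section SINR

variable (p : Params) (w : AccessScheme) (wb : BackhaulScheme) (f : Frame) (i : ℕ)

lemma measurable_interf (z y : Node) :
    Measurable fun ω : Geo × Marks × Temp => interf p i ω.1 ω.2.2 z y := by
  refine Measurable.div (ENNReal.measurable_ofReal.comp ?_)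
    (ENNReal.measurable_ofReal.comp ((measurable_pathLoss p z y).comp measurable_fst))
  fun_prop

lemma measurable_signal (z y : Node) :
    Measurable fun ω : Geo × Marks × Temp => signal p i ω.1 ω.2.2 z y := by
  refine Measurable.div (ENNReal.measurable_ofReal.comp ?_)
    (ENNReal.measurable_ofReal.comp ((measurable_pathLoss p z y).comp measurable_fst))
  fun_prop

lemma measurable_schedUE (b : BS) (k : ℕ) :
    Measurable fun ω : Geo × Marks × Temp => SchedUE p i ω.1 ω.2.2 b k :=
  measurable_winner (fun k => ((measurable_serves p b (.ue k)).comp measurable_fst).and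
    ((measurable_isUL p k).comp measurable_fst)) (fun k => by fun_prop) k

lemma measurable_interfUE (z : Node) (b : BS) :
    Measurable fun ω : Geo × Marks × Temp => interfUE p i ω.1 ω.2.2 z b :=
  Measurable.tsum fun k =>
    (measurable_ind_prop (measurable_schedUE p i b k)).mul (measurable_interf p i z (.ue k))

lemma measurable_fad (b : BS) :
    Measurable fun ω : Geo × Marks × Temp => fad w f ω.2.1 ω.2.2 b := by
  have h : Measurable fun ω : Geo × Marks × Temp => (ω.2.1.1 b, ω.2.2.2.2 (.round b)) := by
    fun_prop
  exact (measurable_fadOf_add w f 0).comp h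

lemma measurable_accessInterf (b : BS) :
    Measurable fun ω : Geo × Marks × Temp => accessInterf p w f i ω.1 ω.2.1 ω.2.2 b := by
  refine Measurable.tsum fun y => measurable_const.mul (Measurable.add ?_ ?_)
  · refine (measurable_ind_prop ?_).mul (measurable_interf p i _ _)
    exact (measurable_le_prop measurable_const (measurable_fad w f y)).and
      (measurable_lt_prop measurable_const (by fun_prop))
  · refine (measurable_ind_prop ?_).mul (measurable_interfUE p i _ _)
    exact (measurable_lt_prop (measurable_fad w f y) measurable_const).and
      (measurable_const.and (measurable_lt_prop measurable_const (by fun_prop)))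

lemma measurable_sinrAccess (b : BS) :
    Measurable fun ω : Geo × Marks × Temp => sinrAccess p w f i ω.1 ω.2.1 ω.2.2 b :=
  (measurable_signal p i _ _).div ((measurable_accessInterf p w f i b).add measurable_const)

lemma measurable_schedSBS (j x : ℕ) (r : Prop) (j' y : ℕ) :
    Measurable fun ω : Geo × Marks × Temp => SchedSBS p i ω.1 ω.2.1 ω.2.2 j x r j' y := by
  have hW : ∀ j', Measurable fun ω : Geo × Marks × Temp =>
      Winner (fun y => Anchors p ω.1 j' y ∧ y ≠ x ∧ 0 < (ω.2.1.1 (.s, y)).1)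
        (fun y => ω.2.2.2.2 (.sbsPrio i y)) y := fun j' =>
    measurable_winner (fun k => ((measurable_anchors p j' k).comp measurable_fst).and
      (measurable_const.and (measurable_lt_prop measurable_const (by fun_prop))))
      (fun k => by fun_prop) y
  exact measurable_const.or <| (measurable_const.and (measurable_const.and (hW j))).or <|
    measurable_const.and ((measurable_lt_prop measurable_const (by fun_prop)).and (hW j'))

lemma measurable_poachInterf (j x : ℕ) (r : Prop) (z : Node) :
    Measurable fun ω : Geo × Marks × Temp => poachInterf p wb i ω.1 ω.2.1 ω.2.2 j x r z := by
  refine measurable_const.mul (Measurable.tsum fun y =>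
    (measurable_ind_prop ?_).mul (measurable_interfUE p i _ _))
  exact measurable_const.and <| (measurable_lt_prop measurable_const (by fun_prop)).and <|
    (Measurable.exists fun j' => measurable_schedSBS p i j x r j' y).not.and <|
      measurable_lt_prop (by fun_prop) measurable_const

lemma measurable_sinrPoach (j x : ℕ) :
    Measurable fun ω : Geo × Marks × Temp => sinrPoach p i ω.1 ω.2.1 ω.2.2 j x :=
  (measurable_signal p i _ _).div <| ((Measurable.tsum fun j' =>
    Measurable.tsum fun y =>
      (measurable_ind_prop (measurable_schedSBS p i j x False j' y)).mul
        (measurable_interf p i _ _)).add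
    (measurable_poachInterf p .UAB i j x False _)).add measurable_const

lemma measurable_sinrBackhaul (j x : ℕ) :
    Measurable fun ω : Geo × Marks × Temp => sinrBackhaul p wb i ω.1 ω.2.1 ω.2.2 j x :=
  (measurable_signal p i _ _).div <| ((Measurable.tsum fun j' =>
    Measurable.tsum fun y =>
      (measurable_ind_prop (measurable_const.and (measurable_schedSBS p i j x True j' y))).mul
        (measurable_interf p i _ _)).add
    (measurable_poachInterf p wb i j x True _)).add measurable_const

end SINR

/-! ### Marginal load of uplink users -/

section Marginal

variable {p : Params} {E : Env p}

lemma upsilon_nonneg (t : Tier) (n₁ n₂ : ℕ) : 0 ≤ upsilon E t n₁ n₂ 4.5 := by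
  have h1 : 0 ≤ meanLoad E t :=
    div_nonneg (mul_nonneg (p.lam_pos _).le ENNReal.toReal_nonneg) (p.lam_pos _).le
  have h2 := p.eta_mem.1
  have h3 : 0 ≤ 1 - p.eta := by linarith [p.eta_mem.2]
  have h4 : 0 ≤ Real.Gamma 3.5 := (Real.Gamma_pos_of_pos (by norm_num)).le
  have h5 : 0 ≤ Real.Gamma (n₁ + n₂ + 4.5) := (Real.Gamma_pos_of_pos (by positivity)).le
  unfold upsilon
  positivity

/-- At mean load zero, division by zero makes `upsilon` vanish identically, so it could not be the
PMF of the probability measure `tagUsers`. The existence of load laws thus forces a positive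
association probability. -/
lemma meanLoad_pos (Λ : Loads E) (t : Tier) : 0 < meanLoad E t := by
  have h1 : 0 ≤ meanLoad E t :=
    div_nonneg (mul_nonneg (p.lam_pos _).le ENNReal.toReal_nonneg) (p.lam_pos _).le
  refine h1.lt_of_ne fun h => ?_
  have hz : ∀ n : ℕ × ℕ, Λ.tagUsers t {n} = 0 := fun n => by
    rw [Λ.tagUsers_pmf t n.1 n.2, upsilon, ← h, Real.zero_rpow (by norm_num)]
    simp
  have h0 : Λ.tagUsers t Set.univ = 0 := by
    rw [← Set.iUnion_of_singleton]
    exact measure_iUnion_null hz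
  simp at h0

/-- Thinning of a gamma-mixed Poisson law: ignoring downlink users leaves a law of the same family
with mean load multiplied by `1 - η`. The argument is `n₁ + 1` because `kappaStar` counts the
typical user. -/
lemma hasSum_upsilon {t : Tier} (hε : 0 < meanLoad E t) (n₁ : ℕ) :
    HasSum (fun n₂ : ℕ => upsilon E t n₁ n₂ 4.5)
      (kappaStar ((1 - p.eta) * meanLoad E t) (n₁ + 1)) := by
  set ε := meanLoad E t with hεdef
  have hη0 := p.eta_mem.1
  have hη1 := p.eta_mem.2
  have hs : 0 < ε + 3.5 := by linarith
  have ha : (0 : ℝ) < n₁ + 4.5 := by positivity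
  have hε' : 0 < 3.5 + (1 - p.eta) * ε := by nlinarith
  have hx0 : 0 ≤ p.eta * ε / (ε + 3.5) := by positivity
  have hx1 : p.eta * ε / (ε + 3.5) < 1 := by rw [div_lt_one hs]; nlinarith
  have h := (hasSum_gamma_mul_pow_div_factorial ha
    (x := p.eta * ε / (ε + 3.5)) (by rwa [abs_of_nonneg hx0])).mul_left
      ((3.5 : ℝ) ^ (3.5 : ℝ) / Real.Gamma 3.5 * ((1 - p.eta) ^ n₁ / n₁.factorial) * ε ^ n₁
        * (ε + 3.5) ^ (-((n₁ : ℝ) + 4.5)))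
  have hval : kappaStar ((1 - p.eta) * ε) (n₁ + 1) = (3.5 : ℝ) ^ (3.5 : ℝ) / Real.Gamma 3.5
      * ((1 - p.eta) ^ n₁ / n₁.factorial) * ε ^ n₁ * (ε + 3.5) ^ (-((n₁ : ℝ) + 4.5))
      * (Real.Gamma (n₁ + 4.5) * (1 - p.eta * ε / (ε + 3.5)) ^ (-((n₁ : ℝ) + 4.5))) := by
    -- The denominator here cancels the power of `ε + 3.5` in the prefactor and leaves the power of
    -- `3.5 + (1 - η) ε` that occurs in `kappaStar`.
    have e1 : 1 - p.eta * ε / (ε + 3.5) = (3.5 + (1 - p.eta) * ε) / (ε + 3.5) := by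
      field_simp; ring
    have e2 : -((n₁ + 1 : ℕ) : ℝ) - 3.5 = -((n₁ : ℝ) + 4.5) := by push_cast; ring
    have e3 : (((n₁ + 1 : ℕ) : ℝ) + 3.5) = (n₁ : ℝ) + 4.5 := by push_cast; ring
    rw [kappaStar, if_neg n₁.succ_ne_zero, e1, e2, e3, Real.div_rpow hε'.le hs.le,
      Nat.add_sub_cancel, mul_pow]
    have h2 := Real.rpow_pos_of_pos hs (-((n₁ : ℝ) + 4.5))
    field_simp
  rw [hval]
  refine (funext fun n₂ => ?_ : (fun n₂ : ℕ => upsilon E t n₁ n₂ 4.5) = _) ▸ h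
  have e1 : 1 + 3.5 / ε = (ε + 3.5) / ε := by field_simp
  have e2 : (1 + 3.5 / ε) ^ ((n₁ : ℝ) + n₂ + 4.5)
      = (ε + 3.5) ^ ((n₁ : ℝ) + 4.5) * (ε + 3.5) ^ n₂ / (ε ^ n₁ * ε ^ n₂ * ε ^ (4.5 : ℝ)) := by
    rw [e1, Real.div_rpow hs.le hε.le, Real.rpow_add hε, Real.rpow_add hε, Real.rpow_natCast,
      Real.rpow_natCast, show (n₁ : ℝ) + n₂ + 4.5 = (n₁ + 4.5) + n₂ by ring, Real.rpow_add hs,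
      Real.rpow_natCast]
  have e3 : (n₁ : ℝ) + n₂ + 4.5 = n₁ + 4.5 + n₂ := by ring
  rw [upsilon, ← hεdef, e2, e3, Real.rpow_neg hs.le, div_pow, mul_pow]
  have h1 := Real.rpow_pos_of_pos hε 4.5
  have h2 := Real.rpow_pos_of_pos hs (n₁ + 4.5)
  field_simp

lemma tsum_upsilon_div_eq_invUL (Λ : Loads E) :
    ∑' n₁ : ℕ, ∑' n₂ : ℕ, ENNReal.ofReal (upsilon E .s n₁ n₂ 4.5) * ENNReal.ofReal (1 / (n₁ + 1))
      = invUL E := by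
  have hm : meanUL E = (1 - p.eta) * meanLoad E .s := by
    simp only [meanUL, meanLoad, Tier.kind]; ring
  have h0 : kappaStar (meanUL E) 0 = 0 := if_pos rfl
  -- The term at 0 vanishes, and the shift `n = n₁ + 1` aligns the two sums.
  rw [invUL, tsum_eq_zero_add' (f := fun n : ℕ => ENNReal.ofReal (kappaStar (meanUL E) n / n))
    ENNReal.summable, h0, zero_div, ENNReal.ofReal_zero, zero_add]
  refine tsum_congr fun n₁ => ?_
  have h := hasSum_upsilon (meanLoad_pos Λ .s) n₁
  rw [ENNReal.tsum_mul_right, ← ENNReal.ofReal_tsum_of_nonneg (upsilon_nonneg .s n₁) h.summable,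
    h.tsum_eq, ← ENNReal.ofReal_mul' (by positivity), hm]
  congr 1
  push_cast
  ring

end Marginal

/-! ### Integrals over the tagged loads and coins -/

section Tagged

variable {p : Params} {E : Env p} (Λ : Loads E)

lemma lintegral_tagUsers (t : Tier) (g : ℕ × ℕ → ℝ≥0∞) :
    ∫⁻ n, g n ∂Λ.tagUsers t
      = ∑' n₁ : ℕ, ∑' n₂ : ℕ, ENNReal.ofReal (upsilon E t n₁ n₂ 4.5) * g (n₁, n₂) := by
  rw [lintegral_countable', ENNReal.tsum_prod']
  simp_rw [Λ.tagUsers_pmf, mul_comm]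

lemma lintegral_tagSBS (g : ℕ → ℝ≥0∞) :
    ∫⁻ n, g n ∂Λ.tagSBS = ∑' n : ℕ, ENNReal.ofReal (kappaStar (meanActiveSBS E) n) * g n := by
  rw [lintegral_countable']
  simp_rw [Λ.tagSBS_pmf, mul_comm]

lemma lintegral_tagLoads_mul (t : Tier) (g : ℕ × ℕ → ℝ≥0∞) (h : ℕ → ℝ≥0∞) :
    ∫⁻ l, g (l.1 t) * h l.2 ∂tagLoadsLaw Λ = (∫⁻ n, g n ∂Λ.tagUsers t) * ∫⁻ n, h n ∂Λ.tagSBS := by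
  have hg : Measurable g := measurable_of_countable g
  have hm : Measurable fun l : Tier → ℕ × ℕ => g (l t) := hg.comp (measurable_pi_apply t)
  rw [tagLoadsLaw, lintegral_prod_mul hm.aemeasurable (measurable_of_countable h).aemeasurable,
    (measurePreserving_eval_infinitePi Λ.tagUsers t).lintegral_comp hg]

lemma lintegral_tagLoads (t : Tier) (g : ℕ × ℕ → ℝ≥0∞) :
    ∫⁻ l, g (l.1 t) ∂tagLoadsLaw Λ = ∫⁻ n, g n ∂Λ.tagUsers t := by
  simpa using lintegral_tagLoads_mul Λ t g 1

/-- A uniformly random choice among the active SBSs of the tagged MBS selects the tagged SBS with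
probability `E[1 / N]`. -/
lemma lintegral_tagSBS_scheduled :
    ∫⁻ n, unif {u | u * (n : ℕ) < 1} ∂Λ.tagSBS = invActive E := by
  rw [lintegral_tagSBS, invActive]
  refine tsum_congr fun n => ?_
  rcases Nat.eq_zero_or_pos n with rfl | hn
  -- An MBS with zero active SBSs would make the coin event certain, but `kappaStar` puts no mass at
  -- 0.
  · simp [kappaStar]
  · rw [unif_mul_lt_one (by exact_mod_cast hn), ← ENNReal.ofReal_mul' (by positivity),
      mul_one_div]

lemma lintegral_tagSBS_not_scheduled :
    ∫⁻ n, unif {u | ¬ u * (n : ℕ) < 1} ∂Λ.tagSBS = 1 - invActive E := by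
  have h : ∀ n : ℕ, unif {u | ¬ u * (n : ℝ) < 1} = 1 - unif {u | u * (n : ℝ) < 1} := fun n =>
    prob_compl_eq_one_sub
      (measurableSet_lt (f := fun u : ℝ => u * n) (by fun_prop) measurable_const)
  have hle : ∀ n : ℕ, unif {u | u * (n : ℝ) < 1} ≤ 1 := fun n => prob_le_one
  simp_rw [h]
  rw [lintegral_sub (measurable_of_countable _), lintegral_tagSBS_scheduled]
  · simp
  · exact ((lintegral_mono hle).trans_lt (by simp)).ne
  · exact .of_forall hle

/-! ### Independent uniform coins -/

variable {ι : Type}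

lemma lintegral_coins (c : ι) {g : ℝ → ℝ≥0∞} (hg : Measurable g) :
    ∫⁻ θ, g (θ c) ∂coins ι = ∫⁻ u, g u ∂unif :=
  (measurePreserving_eval_infinitePi (fun _ : ι => unif) c).lintegral_comp hg

lemma iIndepFun_coins : iIndepFun (fun (c : ι) (θ : ι → ℝ) => θ c) (coins ι) :=
  iIndepFun_infinitePi (P := fun _ : ι => unif) (X := fun _ u => u) fun _ => measurable_id

lemma lintegral_coins_mul {c d : ι} (hcd : c ≠ d) {g h : ℝ → ℝ≥0∞} (hg : Measurable g)
    (hh : Measurable h) :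
    ∫⁻ θ, g (θ c) * h (θ d) ∂coins ι = (∫⁻ u, g u ∂unif) * ∫⁻ u, h u ∂unif := by
  rw [← lintegral_coins c hg, ← lintegral_coins d hh]
  exact lintegral_mul_eq_lintegral_mul_lintegral_of_indepFun (by fun_prop) (by fun_prop)
    ((iIndepFun_coins.indepFun hcd).comp hg hh)

lemma lintegral_coins_mul_mul {c d e : ι} (hcd : c ≠ d) (hce : c ≠ e) (hde : d ≠ e)
    {g h k : ℝ → ℝ≥0∞} (hg : Measurable g) (hh : Measurable h) (hk : Measurable k) :
    ∫⁻ θ, g (θ c) * h (θ d) * k (θ e) ∂coins ι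
      = (∫⁻ u, g u ∂unif) * (∫⁻ u, h u ∂unif) * ∫⁻ u, k u ∂unif := by
  rw [← lintegral_coins_mul hcd hg hh, ← lintegral_coins e hk]
  have hm : Measurable fun q : ℝ × ℝ => g q.1 * h q.2 := by fun_prop
  exact lintegral_mul_eq_lintegral_mul_lintegral_of_indepFun (by fun_prop) (by fun_prop)
    ((iIndepFun_coins.indepFun_prodMk (fun _ => by fun_prop) c d e hce hde).comp hm hk)

/-- Trades the random lower limit of summation for an indicator, so that expectations can be taken
slot by slot over a fixed range. -/
lemma fadMean_sum_Ioc (w : AccessScheme) (f : Frame) (nu nd : ℕ) (e : ℕ → ℝ≥0∞) :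
    fadMean w f nu nd (fun Fad => ∑ i ∈ Finset.Ioc Fad f.Fa, e i)
      = ∑ i ∈ Finset.Ioc 0 f.Fa, fadMean w f nu nd (fun Fad => ind (Fad < i)) * e i := by
  have hs : ∀ Fad, ∑ i ∈ Finset.Ioc Fad f.Fa, e i
      = ∑ i ∈ Finset.Ioc 0 f.Fa, ind (Fad < i) * e i := fun Fad => by
    simp_rw [ind, ite_mul, one_mul, zero_mul]
    rw [← Finset.sum_filter]
    congr 1
    ext i
    simp only [Finset.mem_Ioc, Finset.mem_filter]
    omega
  have hm : ∀ i, Measurable fun u => ind (fadOf w f nu nd u < i) := fun i =>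
    measurable_ind_prop (measurable_lt_prop (measurable_fadOf w f nu nd) measurable_const)
  simp_rw [hs, ← lintegral_fadOf]
  have hme : ∀ i ∈ Finset.Ioc 0 f.Fa, Measurable fun u => ind (fadOf w f nu nd u < i) * e i :=
    fun i _ => (hm i).mul measurable_const
  rw [lintegral_finsetSum _ hme]
  exact Finset.sum_congr rfl fun i _ => lintegral_mul_const _ (hm i)

end Tagged

/-! ### Separation of the tagged loads and coins from the network -/

section Separation

variable {p : Params} {E : Env p} (Λ : Loads E)
  {H : ℕ → Geo × Marks × Temp → ℝ≥0∞} {K : ℕ → TagLoads × (TagCoin → ℝ) → ℝ≥0∞}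

/-- Independence of the tagged variables from the network. Each group has a spatial and a temporal
component, so the product is split twice: over `θ` for a fixed spatial state (`h1`), then over marks
and tagged loads for a fixed geometry (`h2`). -/
lemma lintegral_separate {H : Geo × Marks × Temp → ℝ≥0∞} {K : TagLoads × (TagCoin → ℝ) → ℝ≥0∞}
    (hH : Measurable H) (hK : Measurable K) :
    ∫⁻ s, ∫⁻ θ, K (s.2.2, θ.2) * H (s.1, s.2.1, θ.1) ∂temporalLaw E ∂spatialLaw Λ
      = (∫⁻ l, ∫⁻ c, K (l, c) ∂coins TagCoin ∂tagLoadsLaw Λ) * ∫⁻ ω, H ω ∂netLaw Λ := by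
  have h1 : ∀ s : Spatial, ∫⁻ θ, K (s.2.2, θ.2) * H (s.1, s.2.1, θ.1) ∂temporalLaw E
      = (∫⁻ tm, H (s.1, s.2.1, tm) ∂tempLaw E) * ∫⁻ c, K (s.2.2, c) ∂coins TagCoin := fun s => by
    have hHs : Measurable fun tm => H (s.1, s.2.1, tm) := by fun_prop
    have hKs : Measurable fun c => K (s.2.2, c) := by fun_prop
    rw [temporalLaw, ← lintegral_prod_mul hHs.aemeasurable hKs.aemeasurable]
    simp_rw [mul_comm]
  have hHi : Measurable fun q : Geo × Marks => ∫⁻ tm, H (q.1, q.2, tm) ∂tempLaw E :=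
    Measurable.lintegral_prod_right' (f := fun r : (Geo × Marks) × Temp => H (r.1.1, r.1.2, r.2))
      (by fun_prop)
  have hKi : Measurable fun l : TagLoads => ∫⁻ c, K (l, c) ∂coins TagCoin :=
    hK.lintegral_prod_right'
  have h2 : ∀ g : Geo, ∫⁻ r : Marks × TagLoads, (∫⁻ tm, H (g, r.1, tm) ∂tempLaw E)
        * ∫⁻ c, K (r.2, c) ∂coins TagCoin ∂(marksLaw Λ).prod (tagLoadsLaw Λ)
      = (∫⁻ mk, ∫⁻ tm, H (g, mk, tm) ∂tempLaw E ∂marksLaw Λ)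
        * ∫⁻ l, ∫⁻ c, K (l, c) ∂coins TagCoin ∂tagLoadsLaw Λ := fun g => by
    have hHg : Measurable fun mk : Marks => ∫⁻ tm, H (g, mk, tm) ∂tempLaw E :=
      hHi.comp measurable_prodMk_left
    rw [lintegral_prod_mul hHg.aemeasurable hKi.aemeasurable]
  simp_rw [h1]
  rw [spatialLaw, lintegral_prod _ (Measurable.aemeasurable (by fun_prop))]
  simp_rw [h2]
  rw [lintegral_mul_const _ hHi.lintegral_prod_right', mul_comm, netLaw,
    lintegral_prod _ hH.aemeasurable]
  congr 1
  refine lintegral_congr fun g => ?_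
  rw [lintegral_prod _ (Measurable.aemeasurable (by fun_prop))]

lemma measurable_sum_separated (hH : ∀ i, Measurable (H i)) (hK : ∀ i, Measurable (K i))
    (a : ℝ≥0∞) (S : Finset ℕ) :
    Measurable fun q : Spatial × Temporal =>
      a * ∑ i ∈ S, K i (q.1.2.2, q.2.2) * H i (q.1.1, q.1.2.1, q.2.1) := by
  fun_prop

lemma lintegral_sum_separated (hH : ∀ i, Measurable (H i)) (hK : ∀ i, Measurable (K i))
    (a : ℝ≥0∞) (S : Finset ℕ) :
    ∫⁻ s, ∫⁻ θ, a * ∑ i ∈ S, K i (s.2.2, θ.2) * H i (s.1, s.2.1, θ.1)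
        ∂temporalLaw E ∂spatialLaw Λ
      = a * ∑ i ∈ S, (∫⁻ l, ∫⁻ c, K i (l, c) ∂coins TagCoin ∂tagLoadsLaw Λ)
          * ∫⁻ ω, H i ω ∂netLaw Λ := by
  have hm : ∀ i, Measurable fun q : Spatial × Temporal =>
      K i (q.1.2.2, q.2.2) * H i (q.1.1, q.1.2.1, q.2.1) := fun i => by fun_prop
  have hms : ∀ i (s : Spatial), Measurable fun θ : Temporal =>
      K i (s.2.2, θ.2) * H i (s.1, s.2.1, θ.1) := fun i s => by fun_prop
  have hmi : ∀ i, Measurable fun s : Spatial =>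
      ∫⁻ θ : Temporal, K i (s.2.2, θ.2) * H i (s.1, s.2.1, θ.1) ∂temporalLaw E := fun i =>
    haveI : SFinite (temporalLaw E) := by unfold temporalLaw; infer_instance
    (hm i).lintegral_prod_right'
  have h1 : ∀ s : Spatial, ∫⁻ θ, a * ∑ i ∈ S, K i (s.2.2, θ.2) * H i (s.1, s.2.1, θ.1)
        ∂temporalLaw E
      = a * ∑ i ∈ S, ∫⁻ θ, K i (s.2.2, θ.2) * H i (s.1, s.2.1, θ.1) ∂temporalLaw E := fun s => by
    rw [lintegral_const_mul _ (Finset.measurable_sum _ fun i _ => hms i s),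
      lintegral_finsetSum _ fun i _ => hms i s]
  simp_rw [h1]
  rw [lintegral_const_mul _ (Finset.measurable_sum _ fun i _ => hmi i),
    lintegral_finsetSum _ fun i _ => hmi i]
  congr 1
  exact Finset.sum_congr rfl fun i _ => lintegral_separate Λ (hH i) (hK i)

end Separation

/-! ### Coverage and spectral efficiency -/

section Coverage

variable {p : Params} {E : Env p} (Λ : Loads E)

/-- Total spectral efficiency, in a slot, of the access link to a base station of tier `t`. -/
noncomputable def logAccess (p : Params) (w : AccessScheme) (f : Frame) (t : Tier) (i : ℕ)
    (ω : Geo × Marks × Temp) : ℝ≥0∞ :=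
  ∑' k : ℕ, ind (Serves p ω.1 (t, k) .user0) * log2p (sinrAccess p w f i ω.1 ω.2.1 ω.2.2 (t, k))

/-- The index `q` pairs the tagged SBS with its MBS. A single sum over pairs lets the layer cake
formula apply once. -/
noncomputable def logPoach (p : Params) (i : ℕ) (ω : Geo × Marks × Temp) : ℝ≥0∞ :=
  ∑' q : ℕ × ℕ, ind (Serves p ω.1 (.s, q.1) .user0 ∧ Anchors p ω.1 q.2 q.1)
    * log2p (sinrPoach p i ω.1 ω.2.1 ω.2.2 q.2 q.1)

noncomputable def logBackhaul (p : Params) (wb : BackhaulScheme) (i : ℕ)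
    (ω : Geo × Marks × Temp) : ℝ≥0∞ :=
  ∑' q : ℕ × ℕ, ind (Serves p ω.1 (.s, q.1) .user0 ∧ Anchors p ω.1 q.2 q.1)
    * log2p (sinrBackhaul p wb i ω.1 ω.2.1 ω.2.2 q.2 q.1)

lemma measurable_serves_net (b : BS) (z : Node) :
    Measurable fun ω : Geo × Marks × Temp => Serves p ω.1 b z :=
  (measurable_serves p b z).comp measurable_fst

lemma measurable_serves_anchors (x j : ℕ) :
    Measurable fun ω : Geo × Marks × Temp =>
      Serves p ω.1 (.s, x) .user0 ∧ Anchors p ω.1 j x :=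
  (measurable_serves_net _ _).and ((measurable_anchors p j x).comp measurable_fst)

lemma measurable_logAccess (w : AccessScheme) (f : Frame) (t : Tier) (i : ℕ) :
    Measurable (logAccess p w f t i) :=
  Measurable.tsum fun _ => (measurable_ind_prop (measurable_serves_net _ _)).mul
    (measurable_log2p.comp (measurable_sinrAccess p w f i _))

lemma measurable_logPoach (i : ℕ) : Measurable (logPoach p i) :=
  Measurable.tsum fun _ => (measurable_ind_prop (measurable_serves_anchors _ _)).mul
    (measurable_log2p.comp (measurable_sinrPoach p i _ _))

lemma measurable_logBackhaul (wb : BackhaulScheme) (i : ℕ) : Measurable (logBackhaul p wb i) :=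
  Measurable.tsum fun _ => (measurable_ind_prop (measurable_serves_anchors _ _)).mul
    (measurable_log2p.comp (measurable_sinrBackhaul p wb i _ _))

/-- Coverage decreases in the threshold, which makes it measurable in `τ`. -/
lemma antitone_measure_exists_lt {Ω ι : Type*} [MeasurableSpace Ω] (μ : Measure Ω)
    (A : ι → Ω → Prop) (X : ι → Ω → ℝ≥0∞) :
    Antitone fun τ : ℝ => μ {ω | ∃ k, A k ω ∧ ENNReal.ofReal τ < X k ω} := by
  intro τ τ' h
  refine measure_mono ?_
  rintro ω ⟨k, hk, hlt⟩
  exact ⟨k, hk, (ENNReal.ofReal_le_ofReal h).trans_lt hlt⟩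

lemma antitone_covAccess (w : AccessScheme) (f : Frame) (t : Tier) (i : ℕ) :
    Antitone (covAccess Λ w f t i) := fun _ _ h =>
  ENNReal.div_le_div_right (antitone_measure_exists_lt _ _ _ h) _

lemma antitone_covPoach (i : ℕ) : Antitone (covPoach Λ i) := by
  intro τ τ' h
  refine ENNReal.div_le_div_right (measure_mono ?_) _
  rintro ω ⟨x, j, hx, hj, hlt⟩
  exact ⟨x, j, hx, hj, (ENNReal.ofReal_le_ofReal h).trans_lt hlt⟩

lemma antitone_covBackhaul (wb : BackhaulScheme) (i : ℕ) : Antitone (covBackhaul Λ wb i) := by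
  intro τ τ' h
  refine ENNReal.div_le_div_right (measure_mono ?_) _
  rintro ω ⟨x, j, hx, hj, hlt⟩
  exact ⟨x, j, hx, hj, (ENNReal.ofReal_le_ofReal h).trans_lt hlt⟩

instance : IsProbabilityMeasure (netLaw Λ) := by unfold netLaw; infer_instance

lemma specEff_covAccess (w : AccessScheme) (f : Frame) (t : Tier) (i : ℕ) :
    specEff (covAccess Λ w f t i) = (∫⁻ ω, logAccess p w f t i ω ∂netLaw Λ) / assoc E t := by
  unfold logAccess covAccess
  rw [lintegral_tsum_ind_mul_log2p (A := fun k (ω : Geo × Marks × Temp) =>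
      Serves p ω.1 (t, k) .user0) (X := fun k (ω : Geo × Marks × Temp) =>
      sinrAccess p w f i ω.1 ω.2.1 ω.2.2 (t, k))
    (fun k => measurableSet_setOfPred.mpr (measurable_serves_net _ _))
    (fun k => measurable_sinrAccess p w f i _)
    (fun k l ω hk hl => congrArg Prod.snd (hk.unique hl))]
  exact specEff_div _ (antitone_measure_exists_lt _ _ _) _

lemma lintegral_serves_anchors_log2p {X : ℕ × ℕ → Geo × Marks × Temp → ℝ≥0∞}
    (hX : ∀ q, Measurable (X q)) :
    specEff (fun τ => netLaw Λ {ω | ∃ x j, Serves p ω.1 (.s, x) .user0 ∧ Anchors p ω.1 j x ∧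
        ENNReal.ofReal τ < X (x, j) ω} / assoc E .s)
      = (∫⁻ ω, ∑' q : ℕ × ℕ, ind (Serves p ω.1 (.s, q.1) .user0 ∧ Anchors p ω.1 q.2 q.1)
          * log2p (X q ω) ∂netLaw Λ) / assoc E .s := by
  rw [lintegral_tsum_ind_mul_log2p (A := fun q (ω : Geo × Marks × Temp) =>
      Serves p ω.1 (.s, q.1) .user0 ∧ Anchors p ω.1 q.2 q.1)
    (fun q => measurableSet_setOfPred.mpr (measurable_serves_anchors _ _)) hX ?_]
  · rw [← specEff_div _ (antitone_measure_exists_lt _ _ _)]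
    simp_rw [Prod.exists, and_assoc]
  · rintro ⟨x, j⟩ ⟨x', j'⟩ ω ⟨hx, hj⟩ ⟨hx', hj'⟩
    obtain rfl : x = x' := congrArg Prod.snd (hx.unique hx')
    obtain rfl : j = j' := hj.unique hj'
    rfl

lemma specEff_covPoach (i : ℕ) :
    specEff (covPoach Λ i) = (∫⁻ ω, logPoach p i ω ∂netLaw Λ) / assoc E .s :=
  lintegral_serves_anchors_log2p Λ fun q => measurable_sinrPoach p i q.2 q.1

lemma specEff_covBackhaul (wb : BackhaulScheme) (i : ℕ) :
    specEff (covBackhaul Λ wb i) = (∫⁻ ω, logBackhaul p wb i ω ∂netLaw Λ) / assoc E .s :=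
  lintegral_serves_anchors_log2p Λ fun q => measurable_sinrBackhaul p wb i q.2 q.1

end Coverage

/-! ### Scheduling weights of the typical user -/

section Weights

/-- The typical user is scheduled in the access slot `i`. -/
noncomputable def accessWeight (w : AccessScheme) (f : Frame) (t : Tier) (i : ℕ)
    (q : TagLoads × (TagCoin → ℝ)) : ℝ≥0∞ :=
  ind (fadOf w f ((q.1.1 t).1 + 1) (q.1.1 t).2 (q.2 .round) < i)
    * ind (q.2 (.ue i) * ((q.1.1 t).1 + 1) < 1)

/-- The typical user is served in the poached slot `i`. -/
noncomputable def poachWeight (p : Params) (i : ℕ) (q : TagLoads × (TagCoin → ℝ)) : ℝ≥0∞ :=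
  ind (¬ q.2 (.sbs i) * q.1.2 < 1) * ind (q.2 (.poach i) < p.pul)
    * ind (q.2 (.ue i) * ((q.1.1 .s).1 + 1) < 1)

/-- The data of the typical user is forwarded in the backhaul slot `i`. -/
noncomputable def backhaulWeight (i : ℕ) (q : TagLoads × (TagCoin → ℝ)) : ℝ≥0∞ :=
  ind (q.2 (.sbs i) * q.1.2 < 1) * ind (q.2 (.data i) * ((q.1.1 .s).1 + 1) < 1)

lemma measurable_accessWeight (w : AccessScheme) (f : Frame) (t : Tier) (i : ℕ) :
    Measurable (accessWeight w f t i) := by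
  have h1 : Measurable fun q : TagLoads × (TagCoin → ℝ) => (q.1.1 t, q.2 .round) := by fun_prop
  exact (measurable_ind_prop (measurable_lt_prop ((measurable_fadOf_add w f 1).comp h1)
    measurable_const)).mul (measurable_ind_prop (measurable_lt_prop (by fun_prop) measurable_const))

lemma measurable_poachWeight (p : Params) (i : ℕ) : Measurable (poachWeight p i) :=
  ((measurable_ind_prop (measurable_lt_prop (by fun_prop) measurable_const).not).mul
    (measurable_ind_prop (measurable_lt_prop (by fun_prop) measurable_const))).mul
    (measurable_ind_prop (measurable_lt_prop (by fun_prop) measurable_const))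

lemma measurable_backhaulWeight (i : ℕ) : Measurable (backhaulWeight i) :=
  (measurable_ind_prop (measurable_lt_prop (by fun_prop) measurable_const)).mul
    (measurable_ind_prop (measurable_lt_prop (by fun_prop) measurable_const))

lemma measurable_ind_mul_lt (x : ℝ) : Measurable fun u : ℝ => ind (u * x < 1) :=
  measurable_ind_prop (measurable_lt_prop (by fun_prop) measurable_const)

lemma measurable_ind_not_mul_lt (x : ℝ) : Measurable fun u : ℝ => ind (¬ u * x < 1) :=
  measurable_ind_prop (measurable_lt_prop (by fun_prop) measurable_const).not

lemma lintegral_ind_mul_lt (x : ℝ) : ∫⁻ u, ind (u * x < 1) ∂unif = unif {u | u * x < 1} :=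
  lintegral_ind (measurableSet_lt (by fun_prop) (by fun_prop))

lemma lintegral_ind_not_mul_lt (x : ℝ) :
    ∫⁻ u, ind (¬ u * x < 1) ∂unif = unif {u | ¬ u * x < 1} :=
  lintegral_ind (measurableSet_lt (f := fun u : ℝ => u * x) (by fun_prop) measurable_const).compl

lemma unif_chosen (n : ℕ) :
    unif {u | u * ((n : ℝ) + 1) < 1} = ENNReal.ofReal (1 / ((n : ℝ) + 1)) :=
  unif_mul_lt_one (by linarith [n.cast_nonneg (α := ℝ)])

variable {p : Params} {E : Env p} (Λ : Loads E)

/-- Given the loads, the rounding coin and the selection coin of the slot are distinct, hence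
independent: one gives the probability that the slot is past the downlink part, the other `1 / (n₁ +
1)`. -/
lemma lintegral_accessWeight (w : AccessScheme) (f : Frame) (t : Tier) (i : ℕ) :
    ∫⁻ l, ∫⁻ c, accessWeight w f t i (l, c) ∂coins TagCoin ∂tagLoadsLaw Λ
      = ∑' n₁ : ℕ, ∑' n₂ : ℕ, ENNReal.ofReal (upsilon E t n₁ n₂ 4.5 / (n₁ + 1))
          * fadMean w f (n₁ + 1) n₂ fun Fad => ind (Fad < i) := by
  have h : ∀ l : TagLoads, ∫⁻ c, accessWeight w f t i (l, c) ∂coins TagCoin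
      = fadMean w f ((l.1 t).1 + 1) (l.1 t).2 (fun Fad => ind (Fad < i))
        * ENNReal.ofReal (1 / (((l.1 t).1 : ℝ) + 1)) := fun l => by
    have hm : Measurable fun u => ind (fadOf w f ((l.1 t).1 + 1) (l.1 t).2 u < i) :=
      measurable_ind_prop (measurable_lt_prop (measurable_fadOf _ _ _ _) measurable_const)
    simp only [accessWeight]
    rw [lintegral_coins_mul (by simp) hm (measurable_ind_mul_lt _),
      lintegral_fadOf w f _ _ fun Fad => ind (Fad < i), lintegral_ind_mul_lt, unif_chosen]
  simp_rw [h]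
  rw [lintegral_tagLoads Λ t fun n : ℕ × ℕ => fadMean w f (n.1 + 1) n.2
    (fun Fad => ind (Fad < i)) * ENNReal.ofReal (1 / ((n.1 : ℝ) + 1)), lintegral_tagUsers]
  refine tsum_congr fun n₁ => tsum_congr fun n₂ => ?_
  rw [← mul_one_div (upsilon _ _ _ _ _), ENNReal.ofReal_mul' (by positivity)]
  ring

lemma lintegral_chosen :
    ∫⁻ n : ℕ × ℕ, ENNReal.ofReal (1 / ((n.1 : ℝ) + 1)) ∂Λ.tagUsers .s = invUL E := by
  rw [lintegral_tagUsers, tsum_upsilon_div_eq_invUL Λ]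

/-- Three distinct coins decide that the SBS is idle, that it poaches and that it picks the typical
user. Once they are integrated out, the two remaining load factors are independent. -/
lemma lintegral_poachWeight (i : ℕ) :
    ∫⁻ l, ∫⁻ c, poachWeight p i (l, c) ∂coins TagCoin ∂tagLoadsLaw Λ
      = (1 - invActive E) * ENNReal.ofReal p.pul * invUL E := by
  have h : ∀ l : TagLoads, ∫⁻ c, poachWeight p i (l, c) ∂coins TagCoin
      = ENNReal.ofReal (1 / (((l.1 .s).1 : ℝ) + 1))
        * (unif {u | ¬ u * (l.2 : ℝ) < 1} * ENNReal.ofReal p.pul) := fun l => by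
    simp only [poachWeight]
    have hp : Measurable fun u : ℝ => ind (u < p.pul) := measurable_ind measurableSet_Iio
    rw [lintegral_coins_mul_mul (by simp) (by simp) (by simp) (measurable_ind_not_mul_lt _) hp
      (measurable_ind_mul_lt _), lintegral_ind_mul_lt, lintegral_ind_not_mul_lt, unif_chosen,
      lintegral_ind measurableSet_Iio, mul_comm]
    congr 2
    exact unif_Iio p.pul_mem.2
  simp_rw [h]
  rw [lintegral_tagLoads_mul Λ .s (fun n : ℕ × ℕ => ENNReal.ofReal (1 / ((n.1 : ℝ) + 1)))
    fun n : ℕ => unif {u | ¬ u * (n : ℝ) < 1} * ENNReal.ofReal p.pul, lintegral_chosen,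
    lintegral_mul_const _ (measurable_of_countable _), lintegral_tagSBS_not_scheduled, mul_comm]

lemma lintegral_backhaulWeight (i : ℕ) :
    ∫⁻ l, ∫⁻ c, backhaulWeight i (l, c) ∂coins TagCoin ∂tagLoadsLaw Λ
      = invActive E * invUL E := by
  have h : ∀ l : TagLoads, ∫⁻ c, backhaulWeight i (l, c) ∂coins TagCoin
      = ENNReal.ofReal (1 / (((l.1 .s).1 : ℝ) + 1)) * unif {u | u * (l.2 : ℝ) < 1} := fun l => by
    simp only [backhaulWeight]
    rw [lintegral_coins_mul (by simp) (measurable_ind_mul_lt _) (measurable_ind_mul_lt _),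
      lintegral_ind_mul_lt, lintegral_ind_mul_lt, unif_chosen, mul_comm]
  simp_rw [h]
  rw [lintegral_tagLoads_mul Λ .s (fun n : ℕ × ℕ => ENNReal.ofReal (1 / ((n.1 : ℝ) + 1)))
    fun n : ℕ => unif {u | u * (n : ℝ) < 1}, lintegral_chosen, lintegral_tagSBS_scheduled,
    mul_comm]

end Weights

/-! ### Mean data per frame -/

section Data

variable (p : Params) (w : AccessScheme) (wb : BackhaulScheme) (f : Frame)
  (s : Spatial) (θ : Temporal)

lemma dataSubframe_eq (t : Tier) :
    dataSubframe p w f s θ t = ENNReal.ofReal (p.W * p.T) * ∑ i ∈ Finset.Ioc 0 f.Fa,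
      accessWeight w f t i (s.2.2, θ.2) * logAccess p w f t i (s.1, s.2.1, θ.1) := by
  have hf : Finset.Ioc (tagFad w f s θ t) f.Fa
      = (Finset.Ioc 0 f.Fa).filter fun i => tagFad w f s θ t < i := by
    ext i
    simp only [Finset.mem_Ioc, Finset.mem_filter]
    omega
  rw [dataSubframe, hf, Finset.sum_filter]
  congr 1
  refine Finset.sum_congr rfl fun i _ => ?_
  simp only [accessWeight, logAccess, ind_and]
  -- The selection event depends on the tier but not on the label `k`, so it factors out of the sum.
  have hc : ∑' k : ℕ, ind (Serves p s.1 (t, k) .user0) * ind (Chosen s θ t (.ue i))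
        * log2p (sinrAccess p w f i s.1 s.2.1 θ.1 (t, k))
      = ind (Chosen s θ t (.ue i)) * ∑' k : ℕ, ind (Serves p s.1 (t, k) .user0)
        * log2p (sinrAccess p w f i s.1 s.2.1 θ.1 (t, k)) := by
    rw [← ENNReal.tsum_mul_left]
    exact tsum_congr fun k => by ring
  rw [hc]
  by_cases h : tagFad w f s θ t < i
  · rw [if_pos h, ind_true (P := fadOf _ _ _ _ _ < i) h, one_mul, Chosen]
  · rw [if_neg h, ind_false (P := fadOf _ _ _ _ _ < i) h, zero_mul, zero_mul]

lemma dataPoach_eq :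
    dataPoach p f s θ = ENNReal.ofReal (p.W * p.T) * ∑ i ∈ Finset.Ioc (f.Fa + f.Fbd) p.F,
      poachWeight p i (s.2.2, θ.2) * logPoach p i (s.1, s.2.1, θ.1) := by
  rw [dataPoach]
  congr 1
  refine Finset.sum_congr rfl fun i _ => ?_
  simp only [poachWeight, logPoach, ENNReal.tsum_prod', ← ENNReal.tsum_mul_left, ind_and, Chosen,
    TagSBSSched]
  refine tsum_congr fun x => tsum_congr fun j => ?_
  ring

lemma dataBackhaul_eq :
    dataBackhaul p wb f s θ = ENNReal.ofReal (p.W * p.T)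
      * ∑ i ∈ Finset.Ioc (f.Fa + f.Fbd) p.F,
        backhaulWeight i (s.2.2, θ.2) * logBackhaul p wb i (s.1, s.2.1, θ.1) := by
  rw [dataBackhaul]
  congr 1
  refine Finset.sum_congr rfl fun i _ => ?_
  simp only [backhaulWeight, logBackhaul, ENNReal.tsum_prod', ← ENNReal.tsum_mul_left, ind_and,
    Chosen, TagSBSSched]
  refine tsum_congr fun x => tsum_congr fun j => ?_
  ring

lemma measurable_dataSubframe (t : Tier) :
    Measurable fun q : Spatial × Temporal => dataSubframe p w f q.1 q.2 t := by
  simp_rw [dataSubframe_eq]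
  exact measurable_sum_separated (fun i => measurable_logAccess w f t i)
    (fun i => measurable_accessWeight w f t i) _ _

lemma measurable_dataPoach :
    Measurable fun q : Spatial × Temporal => dataPoach p f q.1 q.2 := by
  simp_rw [dataPoach_eq]
  exact measurable_sum_separated (fun i => measurable_logPoach i)
    (fun i => measurable_poachWeight p i) _ _

lemma measurable_dataBackhaul :
    Measurable fun q : Spatial × Temporal => dataBackhaul p wb f q.1 q.2 := by
  simp_rw [dataBackhaul_eq]
  exact measurable_sum_separated (fun i => measurable_logBackhaul wb i)
    measurable_backhaulWeight _ _

lemma measurable_dataAccess :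
    Measurable fun q : Spatial × Temporal => dataAccess p w wb f q.1 q.2 :=
  (measurable_dataSubframe p w f .s).add (measurable_const.mul (measurable_dataPoach p f))

variable {p} {E : Env p} (Λ : Loads E)

instance : IsProbabilityMeasure (temporalLaw E) := by unfold temporalLaw; infer_instance

instance : IsProbabilityMeasure (spatialLaw Λ) := by unfold spatialLaw; infer_instance

/-- Both sides are brought to one sum over slots of mean weight times mean logarithm; the
normalization by `assoc E t` is absorbed into the coverage. -/
lemma lintegral_dataSubframe (t : Tier) :
    (∫⁻ s, ∫⁻ θ, dataSubframe p w f s θ t ∂temporalLaw E ∂spatialLaw Λ) / assoc E t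
      = ENNReal.ofReal (p.W * p.T) * accessTerm Λ w t f := by
  simp_rw [dataSubframe_eq]
  rw [lintegral_sum_separated Λ (fun i => measurable_logAccess w f t i)
    (fun i => measurable_accessWeight w f t i), accessTerm]
  simp_rw [specEff_sum _ _ fun i => antitone_covAccess Λ w f t i, fadMean_sum_Ioc,
    lintegral_accessWeight, specEff_covAccess]
  rw [mul_div_assoc, ENNReal.div_eq_inv_mul, mul_comm _⁻¹, Finset.sum_mul]
  simp_rw [Finset.mul_sum]
  have hswap : ∀ g : ℕ → ℕ → ℕ → ℝ≥0∞,
      ∑' n₁ : ℕ, ∑' n₂ : ℕ, ∑ i ∈ Finset.Ioc 0 f.Fa, g n₁ n₂ i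
        = ∑ i ∈ Finset.Ioc 0 f.Fa, ∑' n₁ : ℕ, ∑' n₂ : ℕ, g n₁ n₂ i := fun g => by
    have h1 : ∀ n₁, ∑' n₂ : ℕ, ∑ i ∈ Finset.Ioc 0 f.Fa, g n₁ n₂ i
        = ∑ i ∈ Finset.Ioc 0 f.Fa, ∑' n₂ : ℕ, g n₁ n₂ i :=
      fun n₁ => Summable.tsum_finsetSum fun i _ => ENNReal.summable
    simp_rw [h1]
    exact Summable.tsum_finsetSum fun i _ => ENNReal.summable
  rw [hswap, ← Finset.mul_sum]
  congr 1
  refine Finset.sum_congr rfl fun i _ => ?_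
  simp_rw [← ENNReal.tsum_mul_right, div_eq_mul_inv, mul_assoc]

lemma lintegral_dataPoach :
    (∫⁻ s, ∫⁻ θ, dataPoach p f s θ ∂temporalLaw E ∂spatialLaw Λ) / assoc E .s
      = ENNReal.ofReal (p.W * p.T) * ((1 - invActive E) * ENNReal.ofReal p.pul * invUL E
        * specEff fun τ => ∑ i ∈ Finset.Ioc (f.Fa + f.Fbd) p.F, covPoach Λ i τ) := by
  simp_rw [dataPoach_eq]
  rw [lintegral_sum_separated Λ (fun i => measurable_logPoach i)
    (fun i => measurable_poachWeight p i), specEff_sum _ _ fun i => antitone_covPoach Λ i]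
  simp_rw [lintegral_poachWeight, specEff_covPoach, div_eq_mul_inv]
  rw [← Finset.mul_sum, ← Finset.sum_mul]
  ring

lemma lintegral_dataBackhaul :
    (∫⁻ s, ∫⁻ θ, dataBackhaul p wb f s θ ∂temporalLaw E ∂spatialLaw Λ) / assoc E .s
      = ENNReal.ofReal (p.W * p.T) * (invActive E * invUL E
        * specEff fun τ => ∑ i ∈ Finset.Ioc (f.Fa + f.Fbd) p.F, covBackhaul Λ wb i τ) := by
  simp_rw [dataBackhaul_eq]
  rw [lintegral_sum_separated Λ (fun i => measurable_logBackhaul wb i)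
    measurable_backhaulWeight, specEff_sum _ _ fun i => antitone_covBackhaul Λ wb i]
  simp_rw [lintegral_backhaulWeight, specEff_covBackhaul, div_eq_mul_inv]
  rw [← Finset.mul_sum, ← Finset.sum_mul]
  ring

lemma ofReal_W_mul_T (p : Params) :
    ENNReal.ofReal (p.W * p.T) = ENNReal.ofReal p.T * ENNReal.ofReal p.W := by
  rw [ENNReal.ofReal_mul p.W_pos.le, mul_comm]

lemma meanDataMBS_eq :
    meanDataMBS Λ w f = ENNReal.ofReal p.T * (ENNReal.ofReal p.W * accessTerm Λ w .m f) := by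
  rw [meanDataMBS, lintegral_dataSubframe, ofReal_W_mul_T, mul_assoc]

lemma measurable_section {α β γ : Type*} [MeasurableSpace α] [MeasurableSpace β]
    [MeasurableSpace γ] {F : α → β → γ} (hF : Measurable fun q : α × β => F q.1 q.2) (a : α) :
    Measurable (F a) :=
  hF.comp measurable_prodMk_left

lemma meanDataAccess_eq : meanDataAccess Λ w wb f = ENNReal.ofReal p.T * formulaA Λ w wb f := by
  have h1 : ∀ s : Spatial, ∫⁻ θ, dataAccess p w wb f s θ ∂temporalLaw E
      = (∫⁻ θ, dataSubframe p w f s θ .s ∂temporalLaw E)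
        + ind (wb = .UAB) * ∫⁻ θ, dataPoach p f s θ ∂temporalLaw E := fun s => by
    have hm1 : Measurable fun θ : Temporal => dataSubframe p w f s θ .s :=
      measurable_section (F := fun s θ => dataSubframe p w f s θ .s)
        (measurable_dataSubframe p w f .s) s
    have hm2 : Measurable fun θ : Temporal => dataPoach p f s θ :=
      measurable_section (F := fun s θ => dataPoach p f s θ) (measurable_dataPoach p f) s
    simp only [dataAccess]
    rw [lintegral_add_left hm1, lintegral_const_mul _ hm2]
  have hm1 : Measurable fun s : Spatial => ∫⁻ θ, dataSubframe p w f s θ .s ∂temporalLaw E :=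
    (measurable_dataSubframe p w f .s).lintegral_prod_right'
  have hm2 : Measurable fun s : Spatial => ∫⁻ θ, dataPoach p f s θ ∂temporalLaw E :=
    (measurable_dataPoach p f).lintegral_prod_right'
  rw [meanDataAccess, lintegral_congr h1, lintegral_add_left hm1, lintegral_const_mul _ hm2,
    ENNReal.add_div,
    lintegral_dataSubframe, mul_div_assoc, lintegral_dataPoach, ofReal_W_mul_T, formulaA]
  ring

lemma meanDataBackhaul_eq : meanDataBackhaul Λ wb f = ENNReal.ofReal p.T * formulaB Λ wb f := by
  rw [meanDataBackhaul, lintegral_dataBackhaul, ofReal_W_mul_T, formulaB]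
  ring

end Data

/-! ### Mean rates -/

section Rates

lemma roundMean_mul_left (x : ℝ) (c : ℝ≥0∞) (g : ℕ → ℝ≥0∞) :
    roundMean x (fun n => c * g n) = c * roundMean x g := by
  unfold roundMean
  ring

lemma frameMean_mul_left (p : Params) (c : ℝ≥0∞) (g : Frame → ℝ≥0∞) :
    frameMean p (fun f => c * g f) = c * frameMean p g := by
  simp only [frameMean, roundMean_mul_left]

lemma frameMean_div (p : Params) (c : ℝ≥0∞) (g : Frame → ℝ≥0∞) :
    frameMean p (fun f => g f / c) = frameMean p g / c := by
  simp_rw [ENNReal.div_eq_inv_mul, frameMean_mul_left]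

/-! ### Interchange of the frame average with integrals -/

section Measure

variable {Ω : Type*} [MeasurableSpace Ω] {μ : Measure Ω}

lemma measurable_roundMean (x : ℝ) {g : ℕ → Ω → ℝ≥0∞} (hg : ∀ n, Measurable (g n)) :
    Measurable fun ω => roundMean x fun n => g n ω :=
  ((hg _).const_mul _).add ((hg _).const_mul _)

lemma lintegral_roundMean (x : ℝ) {g : ℕ → Ω → ℝ≥0∞} (hg : ∀ n, Measurable (g n)) :
    ∫⁻ ω, roundMean x (fun n => g n ω) ∂μ = roundMean x fun n => ∫⁻ ω, g n ω ∂μ := by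
  unfold roundMean
  rw [lintegral_add_left ((hg _).const_mul _), lintegral_const_mul _ (hg _),
    lintegral_const_mul _ (hg _)]

lemma lintegral_frameMean (p : Params) {g : Frame → Ω → ℝ≥0∞} (hg : ∀ f, Measurable (g f)) :
    ∫⁻ ω, frameMean p (fun f => g f ω) ∂μ = frameMean p fun f => ∫⁻ ω, g f ω ∂μ := by
  unfold frameMean
  have h1 : ∀ Fa Fbd, Measurable fun ω =>
      roundMean (p.gammaA * (Fa : ℕ)) fun Fad => g ⟨Fa, Fbd, Fad⟩ ω :=
    fun _ _ => measurable_roundMean _ fun _ => hg _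
  have h2 : ∀ Fa : ℕ, Measurable fun ω => roundMean (p.eta * ((p.F : ℝ) - Fa)) fun Fbd =>
      roundMean (p.gammaA * Fa) fun Fad => g ⟨Fa, Fbd, Fad⟩ ω :=
    fun _ => measurable_roundMean _ fun _ => h1 _ _
  rw [lintegral_roundMean _ h2]
  congr 1
  funext Fa
  rw [lintegral_roundMean _ (h1 Fa)]
  congr 1
  funext Fbd
  exact lintegral_roundMean _ fun _ => hg _

end Measure

lemma frameTime_eq (p : Params) : frameTime p = ENNReal.ofReal p.T * p.F := by
  rw [frameTime, ENNReal.ofReal_mul p.T_pos.le, ENNReal.ofReal_natCast]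

lemma mul_div_frameTime (p : Params) (a : ℝ≥0∞) :
    ENNReal.ofReal p.T * a / frameTime p = a / p.F := by
  rw [frameTime_eq]
  exact ENNReal.mul_div_mul_left _ _ (by simpa using p.T_pos) ENNReal.ofReal_ne_top

variable {p : Params} {E : Env p} (Λ : Loads E) (w : AccessScheme) (wb : BackhaulScheme)

lemma meanRateMBS_eq : meanRateMBS Λ w = formulaM Λ w := by
  have h : meanDataMBS Λ w = fun f => _ := funext fun f => meanDataMBS_eq w f Λ
  rw [meanRateMBS, formulaM, h]
  simp_rw [frameMean_mul_left]
  rw [mul_div_frameTime, ENNReal.ofReal_div_of_pos (by exact_mod_cast p.F_pos),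
    ENNReal.ofReal_natCast]
  simp only [div_eq_mul_inv]
  ring

/-- The slot duration is a common factor of both arguments, so it comes out of the minimum and
cancels against the frame duration. -/
lemma approxRateSBS_eq : approxRateSBS Λ w wb = formulaS Λ w wb := by
  rw [approxRateSBS, formulaS]
  simp_rw [meanDataAccess_eq, meanDataBackhaul_eq, ← mul_min, frameMean_mul_left]
  rw [mul_div_frameTime, frameMean_div]

/-- The minimum lies below each argument pointwise in `s`; integrating each bound and exchanging
integral with frame average turns the two arguments into the per-frame means already computed. -/
lemma exactRateSBS_le :
    exactRateSBS Λ w wb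
      ≤ min (frameMean p (formulaA Λ w wb)) (frameMean p (formulaB Λ wb)) / p.F := by
  have hA : (∫⁻ s, frameMean p (fun f => ∫⁻ θ, dataAccess p w wb f s θ ∂temporalLaw E)
      ∂spatialLaw Λ) / assoc E .s = ENNReal.ofReal p.T * frameMean p (formulaA Λ w wb) := by
    rw [lintegral_frameMean p fun f => (measurable_dataAccess p w wb f).lintegral_prod_right',
      ← frameMean_div, ← frameMean_mul_left]
    exact congrArg _ (funext fun f => meanDataAccess_eq w wb f Λ)
  have hB : (∫⁻ s, frameMean p (fun f => ∫⁻ θ, dataBackhaul p wb f s θ ∂temporalLaw E)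
      ∂spatialLaw Λ) / assoc E .s = ENNReal.ofReal p.T * frameMean p (formulaB Λ wb) := by
    rw [lintegral_frameMean p fun f => (measurable_dataBackhaul p wb f).lintegral_prod_right',
      ← frameMean_div, ← frameMean_mul_left]
    exact congrArg _ (funext fun f => meanDataBackhaul_eq wb f Λ)
  rw [exactRateSBS, ← mul_div_frameTime, mul_min, ← hA, ← hB]
  refine ENNReal.div_le_div_right (le_min ?_ ?_) _
  · exact ENNReal.div_le_div_right (lintegral_mono fun s => min_le_left _ _) _
  · exact ENNReal.div_le_div_right (lintegral_mono fun s => min_le_right _ _) _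

end Rates

end MmWave

theorem theorem2 (p : Params) (E : Env p) (Λ : Loads E) (w : AccessScheme)
    (wb : BackhaulScheme) :
    approxMeanRate Λ w wb = assoc E .m * formulaM Λ w + assoc E .s * formulaS Λ w wb
    ∧ meanRateMBS Λ w = formulaM Λ w
    ∧ approxRateSBS Λ w wb = formulaS Λ w wb
    ∧ (∀ f : Frame, meanDataAccess Λ w wb f = ENNReal.ofReal p.T * formulaA Λ w wb f
        ∧ meanDataBackhaul Λ wb f = ENNReal.ofReal p.T * formulaB Λ wb f)
    ∧ exactMeanRate Λ w wb ≤ assoc E .m * formulaM Λ w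
        + assoc E .s * (min (frameMean p (formulaA Λ w wb)) (frameMean p (formulaB Λ wb)) / p.F)
      := by
  refine ⟨?_, meanRateMBS_eq Λ w, approxRateSBS_eq Λ w wb,
    fun f => ⟨meanDataAccess_eq w wb f Λ, meanDataBackhaul_eq wb f Λ⟩, ?_⟩
  · rw [approxMeanRate, meanRateMBS_eq, approxRateSBS_eq]
  · rw [exactMeanRate, meanRateMBS_eq]
    gcongr
    exact exactRateSBS_le Λ w wb
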